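/- Let $f=(f_1,f_2):\mathbb{R}^2\to\mathbb{R}^2$ be a dominant polynomial map with $f_1(0)\neq 0$ and $f_2(0)\neq 0$. Let $A_i\subset\mathbb{R}^2$ be the Newton polytope of $f_i$ (the convex hull of its support), let $A=A_1+A_2$ be the Minkowski sum, and let $\Gamma$ be an edge of $A$, with summands $\Gamma=\Gamma_1+\Gamma_2$, where $\Gamma_i$ is a face of $A_i$. Let $a_1$ be a vertex of $\Gamma$ closest to the origin (either one, if both are at the same distance), and write $a_1=b_1+b_2$ with $b_i$ a vertex of $\Gamma_i$. Let $v\in\mathbb{Z}^2$ be the primitive vector pointing from $a_1$ along $\Gamma$, let $w\in\mathbb{Z}^2$ be such that $(v,w)$ is a basis of $\mathbb{Z}^2$ and $A-a_1\subset\{sv+tw \mid s,t\geq 0\}$, and let $U\in\mathrm{GL}(2,\mathbb{Z})$ be the matrix with $Uv=(1,0)$, $Uw=(0,1)$. For $y\in\mathbb{R}^2$ let $\overline{U}(f-y)$ be the pair of polynomials in $z=(z_1,z_2)$ obtained from $x^{-b_1}(f_1-y_1)$, $x^{-b_2}(f_2-y_2)$ by replacing each monomial $x^{a}$ by $z^{Ua}$;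 all exponents that occur are nonnegative. Fix $\rho\in\mathbb{R}\setminus\{0\}$. For $y\in\mathbb{R}^2$ let $\mu_\rho(y)\in\mathbb{N}\cup\{\infty\}$ be the multiplicity of $(\rho,0)$ as a solution of $\overline{U}(f-y)=0$, that is, the dimension over $\mathbb{R}$ of the quotient of the local ring of the plane at $(\rho,0)$ by the ideal generated by the two polynomials ($0$ if $(\rho,0)$ is not a solution). Let $\mathrm{AF}^\rho_{\mathbb{R}}(\Gamma)$ be the set of all $y\in\mathbb{R}^2$ at which $\mu_\rho$ is larger than its minimal value on $\mathbb{R}^2$. Let $\mathrm{TF}^\rho_{\mathbb{R}}(\Gamma)$ be the Euclidean closure of the set of all $y\in\mathbb{R}^2$ such that $\overline{U}(f-y)(\rho,0)=0$ and there are sequences $\varrho_k\in(\mathbb{R}\setminus\{0\})^2$ and $y_k\in\mathbb{R}^2$ with $\varrho_k\to(\rho,0)$, $y_k\to y$ and $\overline{U}(f-y_k)(\varrho_k)=0$ for all $k$. If there are $p\in \mathrm{AF}^\rho_{\mathbb{R}}(\Gamma)$ and $q\in\mathbb{R}^2\setminus \mathrm{AF}^\rho_{\mathbb{R}}(\Gamma)$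 such that $\mu_\rho(p)$ and $\mu_\rho(q)$ are finite and $\mu_\rho(p)-\mu_\rho(q)$ is odd, then $\mathrm{TF}^\rho_{\mathbb{R}}(\Gamma)\neq\emptyset$. -/

import Mathlib

open scoped Pointwise

namespace FaceMultiplicity

/-- The real point with the same coordinates as a lattice point. -/
def latticePoint (a : Fin 2 → ℤ) : Fin 2 → ℝ := fun i => (a i : ℝ)

/-- The exponent vector of a monomial, as a lattice point. -/
def exponentVector (a : Fin 2 →₀ ℕ) : Fin 2 → ℤ := fun i => (a i : ℤ)

section Polygons

/-- The Newton polytope of a polynomial in two variables: the convex hull of its support. -/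
def newtonPolytope {K : Type*} [CommRing K] (P : MvPolynomial (Fin 2) K) : Set (Fin 2 → ℝ) :=
  convexHull ℝ ((fun a => latticePoint (exponentVector a)) '' (P.support : Set (Fin 2 →₀ ℕ)))

/-- The Newton polytope of a pair of polynomials: the Minkowski sum of the two polytopes. -/
def newtonPolytopePair {K : Type*} [CommRing K] (f : Fin 2 → MvPolynomial (Fin 2) K) :
    Set (Fin 2 → ℝ) :=
  newtonPolytope (f 0) + newtonPolytope (f 1)

/-- `F` is the face of `A` on which some linear function `x ↦ ⟨c, x⟩` attains its minimum. -/
def IsFace (A F : Set (Fin 2 → ℝ)) : Prop :=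
  ∃ c : Fin 2 → ℝ, F = {x | x ∈ A ∧ ∀ z ∈ A, c ⬝ᵥ x ≤ c ⬝ᵥ z}

/-- An edge is a face of dimension one. -/
def IsEdge (A Γ : Set (Fin 2 → ℝ)) : Prop :=
  IsFace A Γ ∧ Module.finrank ℝ (vectorSpan ℝ Γ) = 1

/-- `a₁` is a vertex of the edge `Γ` that is closest to the origin for the Euclidean distance
(either vertex qualifies if both are at the same distance). -/
def IsBaseVertex (Γ : Set (Fin 2 → ℝ)) (a₁ : Fin 2 → ℤ) : Prop :=
  latticePoint a₁ ∈ Γ.extremePoints ℝ ∧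
    ∀ c ∈ Γ.extremePoints ℝ, latticePoint a₁ ⬝ᵥ latticePoint a₁ ≤ c ⬝ᵥ c

/-- `(b 0, b 1)` is the decomposition `a₁ = b 0 + b 1` of the vertex `a₁` of the edge `Γ`, where
`b i` is a vertex of the `i`-th summand of `Γ`; the summands are the faces `Γ₁` of `A₁` and `Γ₂`
of `A₂` such that `Γ = Γ₁ + Γ₂`. -/
def IsVertexDecomposition (A₁ A₂ Γ : Set (Fin 2 → ℝ)) (a₁ : Fin 2 → ℤ)
    (b : Fin 2 → Fin 2 → ℤ) : Prop :=
  ∃ Γ₁ Γ₂ : Set (Fin 2 → ℝ), IsFace A₁ Γ₁ ∧ IsFace A₂ Γ₂ ∧ Γ = Γ₁ + Γ₂ ∧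
    latticePoint (b 0) ∈ Γ₁.extremePoints ℝ ∧ latticePoint (b 1) ∈ Γ₂.extremePoints ℝ ∧
    b 0 + b 1 = a₁

/-- The set of toric transformations of the edge `Γ` of `A` with base vertex `a₁`.
Here `v` is the primitive vector from `a₁` along `Γ`, the pair `(v, w)` is a basis of `ℤ²`, and
`A - a₁` lies in the cone spanned by `v` and `w`. The matrix `U` is the inverse transpose of the
matrix with rows `v` and `w`; thus `U v = (1, 0)` and `U w = (0, 1)`. -/
def toricTransformations (A Γ : Set (Fin 2 → ℝ)) (a₁ : Fin 2 → ℤ) :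
    Set (Matrix (Fin 2) (Fin 2) ℤ) :=
  {U | ∃ v w : Fin 2 → ℤ,
    IsCoprime (v 0) (v 1) ∧
    (∃ t : ℝ, 0 < t ∧ latticePoint a₁ + t • latticePoint v ∈ Γ) ∧
    IsUnit (Matrix.of ![v, w]).det ∧
    (∀ x ∈ A, ∃ s t : ℝ, 0 ≤ s ∧ 0 ≤ t ∧
      x - latticePoint a₁ = s • latticePoint v + t • latticePoint w) ∧
    U = ((Matrix.of ![v, w])⁻¹).transpose}

end Polygons

section Systems

variable {K : Type*} [Field K]

/-- The polynomial map `K² → K²` given by `f` is dominant: its image is Zariski dense. -/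
def IsDominant (f : Fin 2 → MvPolynomial (Fin 2) K) : Prop :=
  ∀ P : MvPolynomial (Fin 2) K,
    (∀ x : Fin 2 → K, MvPolynomial.eval (fun i => MvPolynomial.eval x (f i)) P = 0) → P = 0

/-- The image of the Laurent polynomial `x^(-b) P` under the toric change of variables
`x^a ↦ z^(U a)`. All exponents `U (a - b)` that occur below are nonnegative, see
`exponent_nonneg`, so that `Int.toNat` does not truncate. -/
noncomputable def toricTransform (U : Matrix (Fin 2) (Fin 2) ℤ) (b : Fin 2 → ℤ)
    (P : MvPolynomial (Fin 2) K) : MvPolynomial (Fin 2) K :=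
  ∑ a ∈ P.support, MvPolynomial.monomial
    (Finsupp.equivFunOnFinite.symm fun i => ((U.mulVec (exponentVector a - b)) i).toNat)
    (P.coeff a)

/-- The pair `z^(-U b₁) U(f₁ - y₁), z^(-U b₂) U(f₂ - y₂)` of polynomials in `z`: the transform of
the system `f - y = 0`, with the denominators cleared. -/
noncomputable def transformedSystem (f : Fin 2 → MvPolynomial (Fin 2) K)
    (U : Matrix (Fin 2) (Fin 2) ℤ) (b : Fin 2 → Fin 2 → ℤ) (y : Fin 2 → K) :
    Fin 2 → MvPolynomial (Fin 2) K :=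
  fun i => toricTransform U (b i) (f i - MvPolynomial.C (y i))

/-- The ideal of polynomials vanishing at a point is prime. -/
instance ker_eval_isPrime (P : Fin 2 → K) :
    (RingHom.ker (MvPolynomial.eval P : MvPolynomial (Fin 2) K →+* K)).IsPrime :=
  RingHom.ker_isPrime _

/-- The local ring of the affine plane at the point `P`. -/
abbrev LocalRingAt (P : Fin 2 → K) : Type _ :=
  Localization.AtPrime (RingHom.ker (MvPolynomial.eval P : MvPolynomial (Fin 2) K →+* K))

/-- The multiplicity of the point `P` as a solution of `g₁ = g₂ = 0`: the dimension over `K` of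
the quotient of the local ring at `P` by the ideal generated by `g₁` and `g₂`. It is `0` if `P` is
not a solution, and `⊤` if the dimension is infinite. -/
noncomputable def multiplicityAt (g : Fin 2 → MvPolynomial (Fin 2) K) (P : Fin 2 → K) : ℕ∞ :=
  Cardinal.toENat (Module.rank K (LocalRingAt P ⧸
    Ideal.span (Set.range fun i => algebraMap (MvPolynomial (Fin 2) K) (LocalRingAt P) (g i))))

/-- `μ_ρ(y)`: the multiplicity of `(ρ, 0)` as a solution of the transformed system of `f - y`. -/
noncomputable def mu (f : Fin 2 → MvPolynomial (Fin 2) K) (U : Matrix (Fin 2) (Fin 2) ℤ)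
    (b : Fin 2 → Fin 2 → ℤ) (ρ : K) (y : Fin 2 → K) : ℕ∞ :=
  multiplicityAt (transformedSystem f U b y) ![ρ, 0]

/-- The algebraic face multiplicity set at `ρ`: the points `y` at which the multiplicity of
`(ρ, 0)` exceeds its minimal value. See `mem_AF_iff`. -/
def AF (f : Fin 2 → MvPolynomial (Fin 2) K) (U : Matrix (Fin 2) (Fin 2) ℤ)
    (b : Fin 2 → Fin 2 → ℤ) (ρ : K) : Set (Fin 2 → K) :=
  {y | ∃ q, mu f U b ρ q < mu f U b ρ y}

/-- The topological face multiplicity set at `ρ`. -/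
def TF [TopologicalSpace K] (f : Fin 2 → MvPolynomial (Fin 2) K)
    (U : Matrix (Fin 2) (Fin 2) ℤ) (b : Fin 2 → Fin 2 → ℤ) (ρ : K) : Set (Fin 2 → K) :=
  closure {y | (∀ i, MvPolynomial.eval ![ρ, 0] (transformedSystem f U b y i) = 0) ∧
    ∃ (z : ℕ → Fin 2 → K) (η : ℕ → Fin 2 → K),
      (∀ k i, z k i ≠ 0) ∧
      Filter.Tendsto z Filter.atTop (nhds ![ρ, 0]) ∧
      Filter.Tendsto η Filter.atTop (nhds y) ∧
      ∀ k i, MvPolynomial.eval (z k) (transformedSystem f U b (η k) i) = 0}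

/-- The points of `AF` are those whose multiplicity is higher than at every point outside. -/
theorem mem_AF_iff (f : Fin 2 → MvPolynomial (Fin 2) K) (U : Matrix (Fin 2) (Fin 2) ℤ)
    (b : Fin 2 → Fin 2 → ℤ) (ρ : K) (y : Fin 2 → K) :
    y ∈ AF f U b ρ ↔ ∀ q, q ∉ AF f U b ρ → mu f U b ρ q < mu f U b ρ y := by
  constructor
  · rintro ⟨r, hr⟩ q hq
    refine lt_of_le_of_lt ?_ hr
    by_contra h
    exact hq ⟨r, not_le.mp h⟩
  · intro h
    by_contra hy
    exact lt_irrefl _ (h y hy)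

/-- There always are points outside `AF`. -/
theorem AF_ne_univ (f : Fin 2 → MvPolynomial (Fin 2) K) (U : Matrix (Fin 2) (Fin 2) ℤ)
    (b : Fin 2 → Fin 2 → ℤ) (ρ : K) : AF f U b ρ ≠ Set.univ := by
  obtain ⟨y, hy⟩ := exists_minimal_of_wellFoundedLT (fun m => m ∈ Set.range (mu f U b ρ))
    ⟨_, 0, rfl⟩
  obtain ⟨x, rfl⟩ := hy.prop
  intro h
  obtain ⟨q, hq⟩ : x ∈ AF f U b ρ := h ▸ Set.mem_univ x
  exact hy.not_lt ⟨q, rfl⟩ hq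

/-- The exponents occurring in the transformed systems are nonnegative. -/
theorem exponent_nonneg {f : Fin 2 → MvPolynomial (Fin 2) K} {Γ : Set (Fin 2 → ℝ)}
    {a₁ : Fin 2 → ℤ} {b : Fin 2 → Fin 2 → ℤ} {U : Matrix (Fin 2) (Fin 2) ℤ}
    (h0 : ∀ i, MvPolynomial.constantCoeff (f i) ≠ 0)
    (hb : IsVertexDecomposition (newtonPolytope (f 0)) (newtonPolytope (f 1)) Γ a₁ b)
    (hU : U ∈ toricTransformations (newtonPolytopePair f) Γ a₁) (y : Fin 2 → K) (i : Fin 2)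
    {a : Fin 2 →₀ ℕ} (ha : a ∈ (f i - MvPolynomial.C (y i)).support) (j : Fin 2) :
    0 ≤ (U.mulVec (exponentVector a - b i)) j := by
  have hmem : a ∈ (f i).support := by
    rw [MvPolynomial.mem_support_iff] at ha ⊢
    by_cases h : a = 0
    · subst h
      exact h0 i
    · simpa [MvPolynomial.coeff_C, Ne.symm h] using ha
  have haA : latticePoint (exponentVector a) ∈ newtonPolytope (f i) :=
    subset_convexHull ℝ _ ⟨a, hmem, rfl⟩
  obtain ⟨Γ₁, Γ₂, ⟨c₁, h₁⟩, ⟨c₂, h₂⟩, -, hb0, hb1, hsum⟩ := hb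
  have hb0 : latticePoint (b 0) ∈ newtonPolytope (f 0) := by
    have := hb0.1
    rw [h₁] at this
    exact this.1
  have hb1 : latticePoint (b 1) ∈ newtonPolytope (f 1) := by
    have := hb1.1
    rw [h₂] at this
    exact this.1
  obtain ⟨v, w, -, -, hdet, hcone, rfl⟩ := hU
  have key : ∃ s t : ℝ, 0 ≤ s ∧ 0 ≤ t ∧
      latticePoint (exponentVector a - b i) = s • latticePoint v + t • latticePoint w := by
    fin_cases i
    · obtain ⟨s, t, hs, ht, h⟩ := hcone _ (Set.add_mem_add haA hb1)
      refine ⟨s, t, hs, ht, h ▸ ?_⟩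
      funext k
      simp [latticePoint, ← hsum]
    · obtain ⟨s, t, hs, ht, h⟩ := hcone _ (Set.add_mem_add hb0 haA)
      refine ⟨s, t, hs, ht, h ▸ ?_⟩
      funext k
      simp [latticePoint, ← hsum]
  obtain ⟨s, t, hs, ht, h⟩ := key
  set e := exponentVector a - b i with he
  set M : Matrix (Fin 2) (Fin 2) ℤ := Matrix.of ![v, w] with hM
  set d := M⁻¹.transpose.mulVec e with hd
  have hdecomp : M.transpose.mulVec d = e := by
    rw [hd, Matrix.mulVec_mulVec, ← Matrix.transpose_mul, Matrix.nonsing_inv_mul _ hdet]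
    simp
  have h2 : ∀ k, (e k : ℝ) = d 0 * v k + d 1 * w k := by
    intro k
    rw [← hdecomp]
    simp [Matrix.mulVec, dotProduct, hM]
    ring
  have h3 : ∀ k, (e k : ℝ) = s * v k + t * w k := by
    intro k
    have := congrFun h k
    simpa [latticePoint] using this
  have hD : ((v 0 : ℝ) * w 1 - v 1 * w 0) ≠ 0 := by
    have : M.det ≠ 0 := hdet.ne_zero
    rw [hM, Matrix.det_fin_two] at this
    simp at this
    exact_mod_cast this
  have e0 := (h2 0).symm.trans (h3 0)
  have e1 := (h2 1).symm.trans (h3 1)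
  have hs' : (d 0 : ℝ) = s := by
    apply mul_right_cancel₀ hD
    linear_combination (w 1 : ℝ) * e0 - (w 0 : ℝ) * e1
  have ht' : (d 1 : ℝ) = t := by
    apply mul_right_cancel₀ hD
    linear_combination (v 0 : ℝ) * e1 - (v 1 : ℝ) * e0
  fin_cases j
  · have : (0 : ℝ) ≤ d 0 := hs' ▸ hs
    exact_mod_cast this
  · have : (0 : ℝ) ≤ d 1 := ht' ▸ ht
    exact_mod_cast this

end Systems

end FaceMultiplicity

open FaceMultiplicity

/-! Suppose the topological set is empty. Then, near `(ρ, 0)` and locally uniformly in the value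
`y`, common zeros of the transformed system lie on the axis `z₂ = 0` (`eventually_isolated`). Some
component `i` contains `y i` with a positive power of `z₂`, since otherwise both equations could be
solved for `y` at nearby points off the axes; its restriction to the axis is a nonzero polynomial
independent of `y`. Hence one small rectangle around `(ρ, 0)` serves all values on the segment from
`p` to `q`: no common zeros on its horizontal sides, no zeros of component `i` on its vertical
sides. The winding number mod 2 along its boundary is therefore the same at `p` and `q`
(`eventually_boundarySign_eq`).

It remains to identify this with the parity of the multiplicity `I(P, Q)`
(`hasLocalSign_of_localRank`). Both obey one Euclidean algorithm. If the restrictions of `P` and `Q`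
to the axis have orders `r ≤ s` at `ρ`, there are `u`, `v` in the first variable with `u(ρ) = 1` and
`u Q - v P = z₂ H`. Then `I(P, Q) = r + I(P, H)`. For the signs, `u Q - v P` is a positive multiple
of `Q` at the zeros of `P`, and removing `z₂` reflects the curve on the bottom side, which costs
`(-1) ^ r` because `P` changes sign along that side exactly when `r` is odd. Induction on the
multiplicity ends at a pair without a common zero at `(ρ, 0)`.

The winding number is handled through `turn`, which compares a continuous square root of `P + iQ`
along a horizontal side with a branch cut along the negative imaginary axis. The vertical sides
contribute nothing, since `P ≠ 0` there keeps the curve off the cut. -/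

namespace FaceMultiplicity

/-! ### Additivity of quotient dimensions -/

section Rank

open Module

/-- The exact sequence `0 → O/(P, H) → O/(P, QH) → O/(P, Q) → 0`. -/
theorem rank_quotient_span_pair_mul {K O : Type*} [Field K] [CommRing O] [IsDomain O] [Algebra K O]
    {P Q : O} (H : O) (hQ : Q ≠ 0) (hPQ : ∀ b, Q ∣ P * b → Q ∣ b) :
    Module.rank K (O ⧸ Ideal.span {P, Q * H}) =
      Module.rank K (O ⧸ Ideal.span {P, Q}) + Module.rank K (O ⧸ Ideal.span {P, H}) := by
  have hle : Ideal.span {P, Q * H} ≤ Ideal.span {P, Q} := by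
    rw [Ideal.span_le]
    rintro x (rfl | rfl)
    · exact Ideal.subset_span (by simp)
    · exact Ideal.mul_mem_right _ _ (Ideal.subset_span (by simp))
  let F : (O ⧸ Ideal.span {P, Q * H}) →ₗ[K] (O ⧸ Ideal.span {P, Q}) :=
    (Ideal.Quotient.factorₐ K hle).toLinearMap
  let G : O →ₗ[K] (O ⧸ Ideal.span {P, Q * H}) :=
    (Ideal.Quotient.mkₐ K _).toLinearMap ∘ₗ LinearMap.mulLeft K Q
  have hF : Function.Surjective F := Ideal.Quotient.factor_surjective hle
  have hG : ∀ a, G a = Ideal.Quotient.mk _ (Q * a) := fun a => rfl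
  have hFm : ∀ a, F (Ideal.Quotient.mk _ a) = Ideal.Quotient.mk _ a := fun a => rfl
  -- Exactness on the left: `Q a = c P + d Q H` forces `Q ∣ P c`, hence `Q ∣ c` by `hPQ`, and `Q`
  -- cancels.
  have hker : LinearMap.ker G = (Ideal.span {P, H}).restrictScalars K := by
    ext a
    rw [LinearMap.mem_ker, hG, Ideal.Quotient.eq_zero_iff_mem, Submodule.restrictScalars_mem,
      Ideal.mem_span_pair, Ideal.mem_span_pair]
    constructor
    · rintro ⟨c, d, h⟩
      obtain ⟨c', hc'⟩ := hPQ c ⟨a - d * H, by linear_combination h⟩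
      refine ⟨c', d, mul_left_cancel₀ hQ ?_⟩
      rw [← h, hc']
      ring
    · rintro ⟨c, d, h⟩
      exact ⟨Q * c, d, by rw [← h]; ring⟩
  have hrange : LinearMap.range G = LinearMap.ker F := by
    ext a
    obtain ⟨a, rfl⟩ := Ideal.Quotient.mk_surjective a
    rw [LinearMap.mem_ker, hFm, Ideal.Quotient.eq_zero_iff_mem, Ideal.mem_span_pair]
    constructor
    · rintro ⟨b, hb⟩
      rw [hG, Ideal.Quotient.eq, Ideal.mem_span_pair] at hb
      obtain ⟨c, d, h⟩ := hb
      exact ⟨-c, b - d * H, by linear_combination -h⟩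
    · rintro ⟨c, d, h⟩
      refine ⟨d, ?_⟩
      rw [hG, Ideal.Quotient.eq, Ideal.mem_span_pair]
      exact ⟨-c, 0, by linear_combination -h⟩
  have e : (O ⧸ Ideal.span {P, H}) ≃ₗ[K] LinearMap.ker F :=
    (Submodule.Quotient.restrictScalarsEquiv K (Ideal.span {P, H})).symm ≪≫ₗ
      Submodule.quotEquivOfEq _ _ hker.symm ≪≫ₗ G.quotKerEquivRange ≪≫ₗ
      LinearEquiv.ofEq _ _ hrange
  rw [e.rank_eq, ← LinearMap.rank_range_add_rank_ker F, rank_range_of_surjective F hF]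

end Rank

/-! ### Intersection multiplicity at a point of the axis -/

section Local

variable {K : Type*} [Field K]

/-- The restriction of a polynomial in two variables to the first coordinate axis. -/
noncomputable def axis : MvPolynomial (Fin 2) K →ₐ[K] Polynomial K :=
  MvPolynomial.aeval ![Polynomial.X, 0]

/-- A polynomial in one variable as a polynomial in the first of two variables. -/
noncomputable def fromAxis : Polynomial K →ₐ[K] MvPolynomial (Fin 2) K :=
  Polynomial.aeval (MvPolynomial.X 0)

@[simp] theorem axis_fromAxis (p : Polynomial K) : axis (fromAxis p) = p := by
  have : (axis.comp fromAxis : Polynomial K →ₐ[K] Polynomial K) = AlgHom.id K _ := by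
    ext
    simp [axis, fromAxis]
  exact DFunLike.congr_fun this p

@[simp] theorem axis_X_one : axis (MvPolynomial.X 1 : MvPolynomial (Fin 2) K) = 0 := by
  simp [axis]

@[simp] theorem eval_fromAxis (p : Polynomial K) (z : Fin 2 → K) :
    MvPolynomial.eval z (fromAxis p) = p.eval (z 0) := by
  have : ((MvPolynomial.aeval z).comp fromAxis : Polynomial K →ₐ[K] K) =
      Polynomial.aeval (z 0) := by
    ext
    simp [fromAxis]
  simpa [MvPolynomial.aeval_eq_eval, Polynomial.aeval_def] using DFunLike.congr_fun this p

theorem eval_axis (P : MvPolynomial (Fin 2) K) (x : K) :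
    (axis P).eval x = MvPolynomial.eval ![x, 0] P := by
  have : ((Polynomial.aeval x).comp axis : MvPolynomial (Fin 2) K →ₐ[K] K) =
      MvPolynomial.aeval ![x, 0] := by
    ext i
    fin_cases i <;> simp [axis]
  simpa [MvPolynomial.aeval_eq_eval, Polynomial.aeval_def] using DFunLike.congr_fun this P

theorem X_one_dvd_sub_fromAxis (P : MvPolynomial (Fin 2) K) :
    MvPolynomial.X 1 ∣ P - fromAxis (axis P) := by
  rw [← Ideal.mem_span_singleton, ← Ideal.Quotient.eq]
  have : ((Ideal.Quotient.mkₐ K (Ideal.span {MvPolynomial.X 1})) :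
      MvPolynomial (Fin 2) K →ₐ[K] _) = (Ideal.Quotient.mkₐ K _).comp (fromAxis.comp axis) := by
    ext i
    fin_cases i <;> simp [axis, fromAxis]
  exact DFunLike.congr_fun this P

theorem X_one_dvd_iff {P : MvPolynomial (Fin 2) K} : MvPolynomial.X 1 ∣ P ↔ axis P = 0 := by
  constructor
  · rintro ⟨c, rfl⟩
    simp
  · intro h
    simpa [h] using X_one_dvd_sub_fromAxis P

variable (ρ : K)

/-- The map from polynomials to the local ring of the plane at `(ρ, 0)`. -/
noncomputable abbrev toLocal :
    MvPolynomial (Fin 2) K →+* LocalRingAt (![ρ, 0] : Fin 2 → K) :=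
  algebraMap (MvPolynomial (Fin 2) K) (LocalRingAt (![ρ, 0] : Fin 2 → K))

theorem isUnit_toLocal {P : MvPolynomial (Fin 2) K} (h : MvPolynomial.eval ![ρ, 0] P ≠ 0) :
    IsUnit (toLocal ρ P) :=
  IsLocalization.map_units _ (⟨P, h⟩ :
    (RingHom.ker (MvPolynomial.eval ![ρ, 0] : MvPolynomial (Fin 2) K →+* K)).primeCompl)

theorem toLocal_injective : Function.Injective (toLocal ρ) :=
  IsLocalization.injective _ (Ideal.primeCompl_le_nonZeroDivisors
    (RingHom.ker (MvPolynomial.eval ![ρ, 0] : MvPolynomial (Fin 2) K →+* K)))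

instance : IsDomain (LocalRingAt (![ρ, 0] : Fin 2 → K)) :=
  IsLocalization.isDomain_localization (Ideal.primeCompl_le_nonZeroDivisors _)

theorem toLocal_X_one_ne_zero : toLocal ρ (MvPolynomial.X 1) ≠ 0 := by
  rw [Ne, map_eq_zero_iff _ (toLocal_injective ρ)]
  exact MvPolynomial.X_ne_zero 1

/-- After clearing denominators, the second variable is a prime dividing neither `P` nor a
denominator, as denominators do not vanish at `(ρ, 0)`. This is the regularity needed for the exact
sequence. -/
theorem toLocal_X_one_dvd_of_dvd_mul {P : MvPolynomial (Fin 2) K} (hP : axis P ≠ 0)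
    (b : LocalRingAt (![ρ, 0] : Fin 2 → K))
    (h : toLocal ρ (MvPolynomial.X 1) ∣ toLocal ρ P * b) :
    toLocal ρ (MvPolynomial.X 1) ∣ b := by
  obtain ⟨c, hc⟩ := h
  obtain ⟨⟨b', s⟩, hb⟩ := IsLocalization.surj
    (RingHom.ker (MvPolynomial.eval ![ρ, 0] : MvPolynomial (Fin 2) K →+* K)).primeCompl b
  obtain ⟨⟨c', s'⟩, hc'⟩ := IsLocalization.surj
    (RingHom.ker (MvPolynomial.eval ![ρ, 0] : MvPolynomial (Fin 2) K →+* K)).primeCompl c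
  have hs : MvPolynomial.eval ![ρ, 0] (s : MvPolynomial (Fin 2) K) ≠ 0 := s.2
  have hs' : MvPolynomial.eval ![ρ, 0] (s' : MvPolynomial (Fin 2) K) ≠ 0 := s'.2
  have hX : Prime (MvPolynomial.X 1 : MvPolynomial (Fin 2) K) := MvPolynomial.X_prime
  have key : (s' : MvPolynomial (Fin 2) K) * P * b' =
      MvPolynomial.X 1 * (c' * (s : MvPolynomial (Fin 2) K)) := by
    apply toLocal_injective ρ
    simp only [map_mul]
    simp only at hb hc'
    rw [← hb, ← hc']
    linear_combination (toLocal ρ s * toLocal ρ s') * hc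
  have hd : MvPolynomial.X 1 ∣ b' := by
    rcases hX.dvd_or_dvd (Dvd.intro _ key.symm) with h | h
    · rcases hX.dvd_or_dvd h with h | h
      · obtain ⟨d, hd⟩ := h
        rw [hd] at hs'
        simp at hs'
      · exact absurd (X_one_dvd_iff.mp h) hP
    · exact h
  have : toLocal ρ (MvPolynomial.X 1) ∣ b * toLocal ρ s := by
    rw [hb]
    exact map_dvd _ hd
  exact (isUnit_toLocal ρ hs).dvd_mul_right.mp this

/-- The dimension of the quotient of the local ring at `(ρ, 0)` by two polynomials. -/
noncomputable def localRank (P Q : MvPolynomial (Fin 2) K) : Cardinal :=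
  Module.rank K (LocalRingAt (![ρ, 0] : Fin 2 → K) ⧸ Ideal.span {toLocal ρ P, toLocal ρ Q})

theorem multiplicityAt_eq (g : Fin 2 → MvPolynomial (Fin 2) K) :
    multiplicityAt g ![ρ, 0] = Cardinal.toENat (localRank ρ (g 0) (g 1)) := by
  have : (Set.range fun i => algebraMap (MvPolynomial (Fin 2) K)
      (LocalRingAt (![ρ, 0] : Fin 2 → K)) (g i)) = {toLocal ρ (g 0), toLocal ρ (g 1)} := by
    ext x
    simp [Fin.exists_fin_two, eq_comm]
  rw [multiplicityAt, localRank, this]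

theorem localRank_comm (P Q : MvPolynomial (Fin 2) K) : localRank ρ P Q = localRank ρ Q P := by
  rw [localRank, localRank, Set.pair_comm]

theorem localRank_eq_zero {P Q : MvPolynomial (Fin 2) K}
    (h : MvPolynomial.eval ![ρ, 0] P ≠ 0 ∨ MvPolynomial.eval ![ρ, 0] Q ≠ 0) :
    localRank ρ P Q = 0 := by
  have : Ideal.span {toLocal ρ P, toLocal ρ Q} = ⊤ := by
    rcases h with h | h
    · exact Ideal.eq_top_of_isUnit_mem _ (Ideal.subset_span (by simp)) (isUnit_toLocal ρ h)
    · exact Ideal.eq_top_of_isUnit_mem _ (Ideal.subset_span (by simp)) (isUnit_toLocal ρ h)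
  rw [localRank, this]
  have : Subsingleton (LocalRingAt (![ρ, 0] : Fin 2 → K) ⧸
    (⊤ : Ideal (LocalRingAt (![ρ, 0] : Fin 2 → K)))) := Ideal.Quotient.subsingleton_iff.mpr rfl
  exact rank_subsingleton' _ _

/-- Since `u` is a unit in the local ring, both pairs generate the same ideal. -/
theorem localRank_mul_sub {u : MvPolynomial (Fin 2) K} (P Q v : MvPolynomial (Fin 2) K)
    (hu : MvPolynomial.eval ![ρ, 0] u ≠ 0) :
    localRank ρ P (u * Q - v * P) = localRank ρ P Q := by
  obtain ⟨w, hw⟩ := (isUnit_toLocal ρ hu).exists_left_inv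
  have : Ideal.span {toLocal ρ P, toLocal ρ (u * Q - v * P)} =
      Ideal.span {toLocal ρ P, toLocal ρ Q} := by
    apply le_antisymm <;> rw [Ideal.span_le]
    · rintro x (rfl | rfl)
      · exact Ideal.subset_span (by simp)
      · refine Ideal.mem_span_pair.mpr ⟨-toLocal ρ v, toLocal ρ u, ?_⟩
        simp only [map_sub, map_mul]
        ring
    · rintro x (rfl | rfl)
      · exact Ideal.subset_span (by simp)
      · refine Ideal.mem_span_pair.mpr ⟨w * toLocal ρ v, w, ?_⟩
        simp only [map_sub, map_mul]
        linear_combination toLocal ρ Q * hw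
  rw [localRank, localRank, this]

theorem localRank_X_one_mul {P : MvPolynomial (Fin 2) K} (hP : axis P ≠ 0)
    (H : MvPolynomial (Fin 2) K) :
    localRank ρ P (MvPolynomial.X 1 * H) =
      localRank ρ P (MvPolynomial.X 1) + localRank ρ P H := by
  rw [localRank, map_mul, rank_quotient_span_pair_mul _ (toLocal_X_one_ne_zero ρ)
    (toLocal_X_one_dvd_of_dvd_mul ρ hP)]
  rfl

/-- The value at `(ρ, 0)` of an element of the local ring. -/
noncomputable def localEval : LocalRingAt (![ρ, 0] : Fin 2 → K) →ₐ[K] K :=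
  IsLocalization.liftAlgHom (M := (RingHom.ker
    (MvPolynomial.eval ![ρ, 0] : MvPolynomial (Fin 2) K →+* K)).primeCompl)
    (f := MvPolynomial.aeval ![ρ, 0])
    (fun s => by
      have hs : MvPolynomial.eval ![ρ, 0] (s : MvPolynomial (Fin 2) K) ≠ 0 := s.2
      simpa [MvPolynomial.aeval_eq_eval] using hs)

theorem localEval_toLocal (P : MvPolynomial (Fin 2) K) :
    localEval ρ (toLocal ρ P) = MvPolynomial.eval ![ρ, 0] P := by
  simp [localEval, toLocal]

theorem mem_span_of_eval_eq_zero {P : MvPolynomial (Fin 2) K}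
    (h : MvPolynomial.eval ![ρ, 0] P = 0) :
    P ∈ Ideal.span {MvPolynomial.X 1, fromAxis (Polynomial.X - Polynomial.C ρ)} := by
  obtain ⟨c, hc⟩ := X_one_dvd_sub_fromAxis P
  rw [← eval_axis] at h
  obtain ⟨d, hd⟩ := Polynomial.dvd_iff_isRoot.mpr h
  refine Ideal.mem_span_pair.mpr ⟨c, fromAxis d, ?_⟩
  rw [hd, map_mul] at hc
  linear_combination -hc

theorem localRank_X_one_linear :
    localRank ρ (MvPolynomial.X 1) (fromAxis (Polynomial.X - Polynomial.C ρ)) = 1 := by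
  -- The two coordinates centered at `(ρ, 0)` generate the maximal ideal, and the residue field is
  -- `K`.
  have hker : RingHom.ker (localEval ρ) = Ideal.span {toLocal ρ (MvPolynomial.X 1),
      toLocal ρ (fromAxis (Polynomial.X - Polynomial.C ρ))} := by
    apply le_antisymm
    · intro a ha
      rw [RingHom.mem_ker] at ha
      obtain ⟨⟨b, s⟩, hb⟩ := IsLocalization.surj
        (RingHom.ker (MvPolynomial.eval ![ρ, 0] : MvPolynomial (Fin 2) K →+* K)).primeCompl a
      have hs : MvPolynomial.eval ![ρ, 0] (s : MvPolynomial (Fin 2) K) ≠ 0 := s.2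
      have hb0 : MvPolynomial.eval ![ρ, 0] b = 0 := by
        rw [← localEval_toLocal]
        simp only at hb
        rw [← hb, map_mul, ha, zero_mul]
      have hmem := Ideal.mem_map_of_mem (toLocal ρ) (mem_span_of_eval_eq_zero ρ hb0)
      rw [Ideal.map_span, Set.image_pair, ← hb] at hmem
      exact (Ideal.mul_unit_mem_iff_mem _ (isUnit_toLocal ρ hs)).mp hmem
    · rw [Ideal.span_le]
      rintro x (rfl | rfl)
      · simp only [SetLike.mem_coe, RingHom.mem_ker]
        rw [localEval_toLocal]
        simp
      · simp only [SetLike.mem_coe, RingHom.mem_ker]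
        rw [localEval_toLocal]
        simp
  have hsurj : Function.Surjective (localEval ρ) := fun c =>
    ⟨algebraMap K _ c, by simp⟩
  have e := (Ideal.quotientKerAlgEquivOfSurjective hsurj).toLinearEquiv
  rw [localRank, ← hker, e.rank_eq, Module.rank_self]

theorem toLocal_linear_ne_zero : toLocal ρ (fromAxis (Polynomial.X - Polynomial.C ρ)) ≠ 0 := by
  rw [Ne, map_eq_zero_iff _ (toLocal_injective ρ)]
  intro h
  apply Polynomial.X_sub_C_ne_zero ρ
  rw [← axis_fromAxis (Polynomial.X - Polynomial.C ρ), h, map_zero]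

theorem localRank_X_one_pow (r : ℕ) :
    localRank ρ (MvPolynomial.X 1) (fromAxis ((Polynomial.X - Polynomial.C ρ) ^ r)) = r := by
  induction r with
  | zero =>
    rw [localRank_eq_zero ρ (Or.inr (by simp))]
    simp
  | succ r ih =>
    rw [localRank, pow_succ', map_mul, map_mul,
      rank_quotient_span_pair_mul _ (toLocal_linear_ne_zero ρ)]
    · have h1 := localRank_X_one_linear ρ
      rw [localRank] at h1 ih
      rw [h1, ih]
      push_cast
      ring
    -- Regularity with the roles exchanged: the second variable divides `d`, because it is regular
    -- modulo the linear form, and then cancels.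
    · rintro b ⟨d, hd⟩
      obtain ⟨c, rfl⟩ := toLocal_X_one_dvd_of_dvd_mul ρ
        (P := fromAxis (Polynomial.X - Polynomial.C ρ))
        (by rw [axis_fromAxis]; exact Polynomial.X_sub_C_ne_zero ρ) d ⟨b, hd.symm⟩
      refine ⟨c, mul_left_cancel₀ (toLocal_X_one_ne_zero ρ) ?_⟩
      rw [hd]
      ring

/-- Modulo the second variable, `P` is its restriction to the axis, which is a unit times a power of
the linear form. -/
theorem localRank_X_one {P : MvPolynomial (Fin 2) K} (hP : axis P ≠ 0) :
    localRank ρ P (MvPolynomial.X 1) = (axis P).rootMultiplicity ρ := by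
  obtain ⟨p, hp, hpr⟩ := Polynomial.exists_eq_pow_rootMultiplicity_mul_and_not_dvd _ hP ρ
  set r := (axis P).rootMultiplicity ρ with hr
  have hp0 : MvPolynomial.eval ![ρ, 0] (fromAxis p) ≠ 0 := by
    rw [Polynomial.dvd_iff_isRoot] at hpr
    simpa using hpr
  obtain ⟨c, hc⟩ := X_one_dvd_sub_fromAxis P
  have hP' : P = fromAxis p * fromAxis ((Polynomial.X - Polynomial.C ρ) ^ r) -
      (-c) * MvPolynomial.X 1 := by
    rw [← map_mul, mul_comm p, ← hp]
    linear_combination hc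
  rw [localRank_comm, hP', localRank_mul_sub ρ _ _ _ hp0, localRank_X_one_pow]

end Local

/-! ### Crossing parity of plane paths via square roots -/

section Turn

open Complex Set ComplexConjugate

/-- A branch of the square root that is continuous off the imaginary axis. -/
noncomputable def sqrtBranch (z : ℂ) : ℂ :=
  if 0 < z.re then z ^ (2⁻¹ : ℂ) else I * (-z) ^ (2⁻¹ : ℂ)

theorem sqrtBranch_sq (z : ℂ) : sqrtBranch z ^ 2 = z := by
  have h (z : ℂ) : (z ^ (2⁻¹ : ℂ)) ^ 2 = z := cpow_nat_inv_pow z two_ne_zero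
  rw [sqrtBranch]
  split_ifs
  · exact h z
  · rw [mul_pow, h, I_sq]
    ring

theorem sqrtBranch_ne_zero {z : ℂ} (hz : z ≠ 0) : sqrtBranch z ≠ 0 := by
  intro h
  apply hz
  rw [← sqrtBranch_sq z, h]
  simp

theorem continuousAt_sqrtBranch {z : ℂ} (hz : z.re ≠ 0) : ContinuousAt sqrtBranch z := by
  rcases hz.lt_or_gt with h | h
  · have hev : (fun z : ℂ => I * (-z) ^ (2⁻¹ : ℂ)) =ᶠ[nhds z] sqrtBranch := by
      filter_upwards [(isOpen_lt continuous_re continuous_const).mem_nhds h] with w hw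
      rw [sqrtBranch, if_neg (not_lt.mpr (le_of_lt hw))]
    refine ContinuousAt.congr ?_ hev
    refine continuousAt_const.mul ?_
    refine ContinuousAt.comp (g := fun z : ℂ => z ^ (2⁻¹ : ℂ)) ?_ continuous_neg.continuousAt
    exact continuousAt_cpow_const (Or.inl (by simpa using h))
  · have hev : (fun z : ℂ => z ^ (2⁻¹ : ℂ)) =ᶠ[nhds z] sqrtBranch := by
      filter_upwards [(isOpen_lt continuous_const continuous_re).mem_nhds h] with w hw
      rw [sqrtBranch, if_pos hw]
    exact (continuousAt_cpow_const (Or.inl h)).congr hev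

theorem conj_cpow_half {z : ℂ} (hz : 0 < z.re) :
    conj (z ^ (2⁻¹ : ℂ)) = conj z ^ (2⁻¹ : ℂ) := by
  have h := cpow_conj z 2⁻¹ (fun h => by
    rw [arg_eq_pi_iff] at h
    linarith [h.1])
  have h2 : conj (2⁻¹ : ℂ) = 2⁻¹ := by
    rw [map_inv₀, map_ofNat]
  rw [h2] at h
  rw [h, conj_conj]

theorem sqrtBranch_conj_of_pos {z : ℂ} (hz : 0 < z.re) :
    sqrtBranch (conj z) = conj (sqrtBranch z) := by
  rw [sqrtBranch, sqrtBranch, if_pos hz, if_pos (by simpa using hz), conj_cpow_half hz]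

/-- The sign comes from the factor `I` in the left half plane; it is the source of the sign in
`turn_neg`. -/
theorem sqrtBranch_conj_of_neg {z : ℂ} (hz : z.re < 0) :
    sqrtBranch (conj z) = -conj (sqrtBranch z) := by
  rw [sqrtBranch, sqrtBranch, if_neg (by simpa using hz.le), if_neg (by simpa using hz.le),
    map_mul, conj_cpow_half (by simpa using hz)]
  simp

theorem eq_of_continuousOn_of_sq_eq_one {f : ℝ → ℂ} {c d : ℝ} (hcd : c ≤ d)
    (hf : ContinuousOn f (Icc c d)) (h : ∀ t ∈ Icc c d, f t ^ 2 = 1) : f c = f d := by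
  have hc : c ∈ Icc c d := left_mem_Icc.mpr hcd
  have hd : d ∈ Icc c d := right_mem_Icc.mpr hcd
  rcases isPreconnected_Icc.eq_or_eq_neg_of_sq_eq hf (continuousOn_const (c := (1 : ℂ)))
    (fun t ht => by simpa using h t ht) (fun _ => one_ne_zero) with h | h
  · rw [h hc, h hd]
  · rw [h hc, h hd]
    rfl

/-- A nowhere vanishing continuous function on a rectangle has a continuous square root. -/
theorem exists_continuous_sqrt {H : ℝ → ℝ → ℂ} (hH : Continuous fun z : ℝ × ℝ => H z.1 z.2)
    {c d a b : ℝ} (hcd : c ≤ d) (hab : a ≤ b)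
    (h0 : ∀ t ∈ Icc c d, ∀ x ∈ Icc a b, H t x ≠ 0) :
    ∃ Ψ : ℝ → ℝ → ℂ, (Continuous fun z : ℝ × ℝ => Ψ z.1 z.2) ∧
      ∀ t ∈ Icc c d, ∀ x ∈ Icc a b, Ψ t x ^ 2 = H t x := by
  -- Clamping both parameters extends `H` from the rectangle to a nowhere zero function on the
  -- simply connected plane, which lifts through the covering `z ↦ z ^ 2` of `ℂ \ {0}`.
  let F : C(ℝ × ℝ, ℂ) :=
    ⟨fun z => H (projIcc c d hcd z.1) (projIcc a b hab z.2),
      hH.comp (f := fun z : ℝ × ℝ => ((projIcc c d hcd z.1 : ℝ), (projIcc a b hab z.2 : ℝ)))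
        ((continuous_subtype_val.comp ((continuous_projIcc (h := hcd)).comp continuous_fst)).prodMk
        (continuous_subtype_val.comp ((continuous_projIcc (h := hab)).comp continuous_snd)))⟩
  have hF : ∀ z, F z ∈ ({0}ᶜ : Set ℂ) := fun z => h0 _ (projIcc c d hcd z.1).2 _
    (projIcc a b hab z.2).2
  obtain ⟨Ψ, ⟨-, hΨ⟩, -⟩ := (isCoveringMapOn_npow (𝕜 := ℂ) 2
    (by simp)).existsUnique_continuousMap_lifts F (a₀ := 0) (e₀ := sqrtBranch (F 0)) (sqrtBranch_sq _) hF
  refine ⟨fun t x => Ψ (t, x), Ψ.continuous, fun t ht x hx => ?_⟩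
  have := congrFun hΨ (t, x)
  simpa [F, projIcc_of_mem hcd ht, projIcc_of_mem hab hx] using this

/-- The plane curve with coordinates `p` and `q`. -/
noncomputable def planePath (p q : ℝ → ℝ) (x : ℝ) : ℂ := p x + q x * I

theorem planePath_re (p q : ℝ → ℝ) (x : ℝ) : (planePath p q x).re = p x := by
  simp [planePath]

theorem planePath_im (p q : ℝ → ℝ) (x : ℝ) : (planePath p q x).im = q x := by
  simp [planePath]

theorem planePath_ne_zero {p q : ℝ → ℝ} {x : ℝ} (h : p x = 0 → q x ≠ 0) :
    planePath p q x ≠ 0 := by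
  intro h0
  have hp : p x = 0 := by rw [← planePath_re p q, h0, zero_re]
  have hq : q x = 0 := by rw [← planePath_im p q, h0, zero_im]
  exact h hp hq

/-- The function `ψ` is a continuous square root of the path with coordinates `p` and `q`. -/
def IsSqrtPath (p q : ℝ → ℝ) (a b : ℝ) (ψ : ℝ → ℂ) : Prop :=
  ContinuousOn ψ (Icc a b) ∧ ∀ x ∈ Icc a b, ψ x ^ 2 = planePath p q x

open Classical in
/-- The parity, as a sign, of the number of times that the path with coordinates `p` and `q`
crosses the negative half of the second axis. -/
noncomputable def turn (p q : ℝ → ℝ) (a b : ℝ) : ℤ :=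
  if ∃ ψ, IsSqrtPath p q a b ψ ∧
    ψ b * sqrtBranch (planePath p q a) = ψ a * sqrtBranch (planePath p q b) then 1 else -1

theorem turn_eq_one_or (p q : ℝ → ℝ) (a b : ℝ) : turn p q a b = 1 ∨ turn p q a b = -1 := by
  rw [turn]
  split_ifs <;> simp

/-- Any continuous square root computes the sign: the quotient of two of them squares to `1`, so it
is constant on the interval. -/
theorem turn_eq {p q : ℝ → ℝ} {a b : ℝ} (hab : a ≤ b) (h0 : ∀ x ∈ Icc a b, p x = 0 → q x ≠ 0)
    {ψ : ℝ → ℂ} (hψ : IsSqrtPath p q a b ψ) {s : ℤ} (hs : s = 1 ∨ s = -1)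
    (h : ψ b * sqrtBranch (planePath p q a) = s * (ψ a * sqrtBranch (planePath p q b))) :
    turn p q a b = s := by
  rcases hs with rfl | rfl
  · exact if_pos ⟨ψ, hψ, by simpa using h⟩
  · refine if_neg ?_
    rintro ⟨ψ', hψ', h'⟩
    have ha : a ∈ Icc a b := left_mem_Icc.mpr hab
    have hb : b ∈ Icc a b := right_mem_Icc.mpr hab
    have hne : ∀ x ∈ Icc a b, ψ x ≠ 0 := fun x hx h1 =>
      planePath_ne_zero (h0 x hx) (by rw [← hψ.2 x hx, h1]; simp)
    have hne' : ψ' a ≠ 0 := fun h1 =>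
      planePath_ne_zero (h0 a ha) (by rw [← hψ'.2 a ha, h1]; simp)
    have hc := eq_of_continuousOn_of_sq_eq_one (f := fun x => ψ' x / ψ x) hab
      (hψ'.1.div hψ.1 hne) (fun x hx => by
        rw [div_pow, hψ.2 x hx, hψ'.2 x hx, div_self (planePath_ne_zero (h0 x hx))])
    rw [div_eq_div_iff (hne a ha) (hne b hb)] at hc
    have hr := sqrtBranch_ne_zero (planePath_ne_zero (h0 b hb))
    have h2 : 2 * (ψ' a * ψ a * sqrtBranch (planePath p q b)) = 0 := by
      push_cast at h
      linear_combination -ψ a * h' + ψ' a * h - sqrtBranch (planePath p q a) * hc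
    have := hne a ha
    simp_all

theorem exists_turn_spec {p q : ℝ → ℝ} (hp : Continuous p) (hq : Continuous q) {a b : ℝ}
    (hab : a ≤ b) (h0 : ∀ x ∈ Icc a b, p x = 0 → q x ≠ 0) :
    ∃ ψ, IsSqrtPath p q a b ψ ∧ ψ b * sqrtBranch (planePath p q a) =
      turn p q a b * (ψ a * sqrtBranch (planePath p q b)) := by
  obtain ⟨Ψ, hΨ, h⟩ := exists_continuous_sqrt (H := fun _ => planePath p q)
    (by unfold planePath; fun_prop) (le_refl (0 : ℝ)) hab
    (fun t _ x hx => planePath_ne_zero (h0 x hx))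
  have hψ : IsSqrtPath p q a b (Ψ 0) := ⟨Continuous.continuousOn (by fun_prop), h 0 (by simp)⟩
  have hsq : (Ψ 0 b * sqrtBranch (planePath p q a)) ^ 2 =
      (Ψ 0 a * sqrtBranch (planePath p q b)) ^ 2 := by
    rw [mul_pow, mul_pow, sqrtBranch_sq, sqrtBranch_sq, hψ.2 a (left_mem_Icc.mpr hab),
      hψ.2 b (right_mem_Icc.mpr hab), mul_comm]
  refine ⟨Ψ 0, hψ, ?_⟩
  rcases sq_eq_sq_iff_eq_or_eq_neg.mp hsq with h1 | h1
  · rw [turn_eq hab h0 hψ (s := 1) (Or.inl rfl) (by simpa using h1)]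
    simpa using h1
  · rw [turn_eq hab h0 hψ (s := -1) (Or.inr rfl) (by simpa using h1)]
    simpa using h1

/-- A square root chosen continuously on the whole parameter rectangle makes the sign a continuous
function of `t` with square `1`. The conditions at `a` and `b` keep the end points where
`sqrtBranch` is continuous; the end points themselves may move. -/
theorem turn_homotopy {p q : ℝ → ℝ → ℝ} (hp : Continuous fun z : ℝ × ℝ => p z.1 z.2)
    (hq : Continuous fun z : ℝ × ℝ => q z.1 z.2) {c d a b : ℝ} (hcd : c ≤ d) (hab : a ≤ b)
    (h0 : ∀ t ∈ Icc c d, ∀ x ∈ Icc a b, p t x = 0 → q t x ≠ 0)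
    (ha : ∀ t ∈ Icc c d, p t a ≠ 0) (hb : ∀ t ∈ Icc c d, p t b ≠ 0) :
    turn (p c) (q c) a b = turn (p d) (q d) a b := by
  have hH : Continuous fun z : ℝ × ℝ => planePath (p z.1) (q z.1) z.2 := by
    unfold planePath
    fun_prop
  have hH0 : ∀ t ∈ Icc c d, ∀ x ∈ Icc a b, planePath (p t) (q t) x ≠ 0 :=
    fun t ht x hx => planePath_ne_zero (h0 t ht x hx)
  obtain ⟨Ψ, hΨ, h⟩ := exists_continuous_sqrt (H := fun t => planePath (p t) (q t)) hH hcd hab hH0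
  have haI : a ∈ Icc a b := left_mem_Icc.mpr hab
  have hbI : b ∈ Icc a b := right_mem_Icc.mpr hab
  have hΨ0 : ∀ t ∈ Icc c d, ∀ x ∈ Icc a b, Ψ t x ≠ 0 := fun t ht x hx h1 =>
    hH0 t ht x hx (by rw [← h t ht x hx, h1]; simp)
  have hr : ∀ x, (∀ t ∈ Icc c d, p t x ≠ 0) →
      ContinuousOn (fun t => sqrtBranch (planePath (p t) (q t) x)) (Icc c d) := by
    intro x hx t ht
    refine ContinuousAt.continuousWithinAt ?_
    refine ContinuousAt.comp (g := sqrtBranch) (f := fun t => planePath (p t) (q t) x)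
      (continuousAt_sqrtBranch ?_) ?_
    · rw [planePath_re]
      exact hx t ht
    · exact (hH.comp (continuous_id.prodMk continuous_const)).continuousAt
  have hr0 : ∀ t ∈ Icc c d, ∀ x ∈ Icc a b, sqrtBranch (planePath (p t) (q t) x) ≠ 0 :=
    fun t ht x hx => sqrtBranch_ne_zero (hH0 t ht x hx)
  set f : ℝ → ℂ := fun t => Ψ t b * sqrtBranch (planePath (p t) (q t) a) /
    (Ψ t a * sqrtBranch (planePath (p t) (q t) b)) with hf
  have hden : ∀ t ∈ Icc c d, Ψ t a * sqrtBranch (planePath (p t) (q t) b) ≠ 0 := fun t ht =>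
    mul_ne_zero (hΨ0 t ht a haI) (hr0 t ht b hbI)
  have hfc : ContinuousOn f (Icc c d) := by
    refine ContinuousOn.div (ContinuousOn.mul ?_ (hr a ha)) (ContinuousOn.mul ?_ (hr b hb)) hden
    · exact (hΨ.comp (continuous_id.prodMk continuous_const)).continuousOn
    · exact (hΨ.comp (continuous_id.prodMk continuous_const)).continuousOn
  have hf1 : ∀ t ∈ Icc c d, f t ^ 2 = 1 := by
    intro t ht
    simp only [hf]
    rw [div_pow, mul_pow, mul_pow, sqrtBranch_sq, sqrtBranch_sq, h t ht a haI, h t ht b hbI,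
      mul_comm, div_self (mul_ne_zero (hH0 t ht a haI) (hH0 t ht b hbI))]
  have hcI : c ∈ Icc c d := left_mem_Icc.mpr hcd
  have hdI : d ∈ Icc c d := right_mem_Icc.mpr hcd
  have hcd' := eq_of_continuousOn_of_sq_eq_one hcd hfc hf1
  obtain ⟨s, hs, hfs⟩ : ∃ s : ℤ, (s = 1 ∨ s = -1) ∧ f c = s := by
    rcases eq_or_eq_neg_of_sq_eq_sq (f c) 1 (by rw [hf1 c hcI, one_pow]) with h1 | h1
    · exact ⟨1, Or.inl rfl, by simpa using h1⟩
    · exact ⟨-1, Or.inr rfl, by simpa using h1⟩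
  have key : ∀ t ∈ Icc c d, f t = s → turn (p t) (q t) a b = s := by
    intro t ht hts
    refine turn_eq hab (h0 t ht) (ψ := Ψ t)
      ⟨(hΨ.comp (continuous_const.prodMk continuous_id)).continuousOn, h t ht⟩ hs ?_
    rwa [hf, div_eq_iff (hden t ht)] at hts
  rw [key c hcI hfs, key d hdI (hcd' ▸ hfs)]

theorem planePath_neg (p q : ℝ → ℝ) (x : ℝ) :
    planePath p (fun x => -q x) x = conj (planePath p q x) := by
  simp [planePath]

/-- Reflecting a path at the first axis changes the sign if the path changes sides. -/
theorem turn_neg {p q : ℝ → ℝ} (hp : Continuous p) (hq : Continuous q) {a b : ℝ}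
    (hab : a ≤ b) (h0 : ∀ x ∈ Icc a b, p x = 0 → q x ≠ 0) (ha : p a ≠ 0) (hb : p b ≠ 0) :
    turn p (fun x => -q x) a b = (if p a * p b < 0 then -1 else 1) * turn p q a b := by
  obtain ⟨ψ, hψ, h⟩ := exists_turn_spec hp hq hab h0
  have hs := turn_eq_one_or p q a b
  set s := turn p q a b
  -- The reflection is complex conjugation, so conjugating `ψ` gives a square root of the reflected
  -- path. Each end point in the left half plane then contributes a factor `-1`.
  have hψ' : IsSqrtPath p (fun x => -q x) a b (fun x => conj (ψ x)) := by
    refine ⟨continuous_conj.comp_continuousOn hψ.1, fun x hx => ?_⟩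
    rw [planePath_neg, ← hψ.2 x hx, map_pow]
  have h' := congrArg conj h
  simp only [map_mul, map_intCast] at h'
  refine turn_eq hab (fun x hx hpx => neg_ne_zero.mpr (h0 x hx hpx)) hψ' ?_ ?_
  · split_ifs <;> rcases hs with hs | hs <;> simp [hs]
  · simp only [planePath_neg]
    rcases ha.lt_or_gt with ha | ha <;> rcases hb.lt_or_gt with hb | hb
    · rw [if_neg (not_lt.mpr (mul_pos_of_neg_of_neg ha hb).le),
        sqrtBranch_conj_of_neg (by rwa [planePath_re]),
        sqrtBranch_conj_of_neg (by rwa [planePath_re])]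
      push_cast
      linear_combination -h'
    · rw [if_pos (mul_neg_of_neg_of_pos ha hb),
        sqrtBranch_conj_of_neg (by rwa [planePath_re]),
        sqrtBranch_conj_of_pos (by rwa [planePath_re])]
      push_cast
      linear_combination -h'
    · rw [if_pos (mul_neg_of_pos_of_neg ha hb),
        sqrtBranch_conj_of_pos (by rwa [planePath_re]),
        sqrtBranch_conj_of_neg (by rwa [planePath_re])]
      push_cast
      linear_combination h'
    · rw [if_neg (not_lt.mpr (mul_pos ha hb).le),
        sqrtBranch_conj_of_pos (by rwa [planePath_re]),
        sqrtBranch_conj_of_pos (by rwa [planePath_re])]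
      push_cast
      linear_combination h'

theorem segment_mul_pos {x y t : ℝ} (hxy : 0 < x * y) (ht : t ∈ Icc (0 : ℝ) 1) :
    0 < x * ((1 - t) * x + t * y) := by
  have hx : x ≠ 0 := left_ne_zero_of_mul hxy.ne'
  have hx2 : 0 < x * x := mul_self_pos.mpr hx
  rcases ht.1.eq_or_lt with h | h
  · rw [← h]
    simpa using hx2
  · nlinarith [mul_pos h hxy, mul_nonneg (sub_nonneg.mpr ht.2) hx2.le]

/-- On a quadrant, the branch of the square root changes under the reflection at the diagonal
by a fixed factor. -/
theorem exists_sqrtBranch_swap {p q p' q' : ℝ} (hp : 0 < p * p') (hq : 0 < q * q') :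
    ∃ k : ℤ, (k = 1 ∨ k = -1) ∧
      sqrtBranch (q + p * I) = k * (sqrtBranch I * conj (sqrtBranch (p + q * I))) ∧
      sqrtBranch (q' + p' * I) = k * (sqrtBranch I * conj (sqrtBranch (p' + q' * I))) := by
  have hseg : ∀ {x y t : ℝ}, 0 < x * y → t ∈ Icc (0 : ℝ) 1 → (1 - t) * x + t * y ≠ 0 :=
    fun hxy ht => right_ne_zero_of_mul (segment_mul_pos hxy ht).ne'
  -- The segment between the two points stays in their open quadrant, where both branch values vary
  -- continuously, so their ratio, of square `1`, is constant.
  set P : ℝ → ℝ := fun t => (1 - t) * p + t * p' with hP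
  set Q : ℝ → ℝ := fun t => (1 - t) * q + t * q' with hQ
  have hP0 : ∀ t ∈ Icc (0 : ℝ) 1, P t ≠ 0 := fun t ht => hseg hp ht
  have hQ0 : ∀ t ∈ Icc (0 : ℝ) 1, Q t ≠ 0 := fun t ht => hseg hq ht
  have hcont : ∀ {A B : ℝ → ℝ}, Continuous A → Continuous B → (∀ t ∈ Icc (0 : ℝ) 1, A t ≠ 0) →
      ContinuousOn (fun t => sqrtBranch (planePath A B t)) (Icc 0 1) := by
    intro A B hA hB h t ht
    refine ContinuousAt.continuousWithinAt ?_
    refine ContinuousAt.comp (g := sqrtBranch) (f := planePath A B)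
      (continuousAt_sqrtBranch ?_) ?_
    · rw [planePath_re]
      exact h t ht
    · unfold planePath
      fun_prop
  have hPc : Continuous P := by fun_prop
  have hQc : Continuous Q := by fun_prop
  have hI : sqrtBranch I ≠ 0 := sqrtBranch_ne_zero I_ne_zero
  have hne : ∀ t ∈ Icc (0 : ℝ) 1, sqrtBranch I * conj (sqrtBranch (planePath P Q t)) ≠ 0 := by
    intro t ht
    refine mul_ne_zero hI ?_
    rw [Ne, map_eq_zero]
    exact sqrtBranch_ne_zero (planePath_ne_zero fun h => absurd h (hP0 t ht))
  set f : ℝ → ℂ := fun t => sqrtBranch (planePath Q P t) /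
    (sqrtBranch I * conj (sqrtBranch (planePath P Q t))) with hf
  have hfc : ContinuousOn f (Icc 0 1) := (hcont hQc hPc hQ0).div
    (continuousOn_const.mul (continuous_conj.comp_continuousOn (hcont hPc hQc hP0))) hne
  have hf1 : ∀ t ∈ Icc (0 : ℝ) 1, f t ^ 2 = 1 := by
    intro t ht
    have hsw : planePath Q P t = I * conj (planePath P Q t) := by
      simp only [planePath, map_add, map_mul, conj_ofReal, conj_I]
      linear_combination (Q t : ℂ) * I_sq
    simp only [hf]
    rw [div_pow, mul_pow, ← map_pow, sqrtBranch_sq, sqrtBranch_sq, sqrtBranch_sq, hsw]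
    refine div_self ?_
    rw [← hsw]
    exact planePath_ne_zero fun h => absurd h (hQ0 t ht)
  have h01 := eq_of_continuousOn_of_sq_eq_one zero_le_one hfc hf1
  have h0 : (0 : ℝ) ∈ Icc (0 : ℝ) 1 := by simp
  have h1 : (1 : ℝ) ∈ Icc (0 : ℝ) 1 := by simp
  obtain ⟨s, hs, hfs⟩ : ∃ s : ℤ, (s = 1 ∨ s = -1) ∧ f 0 = s := by
    rcases eq_or_eq_neg_of_sq_eq_sq (f 0) 1 (by rw [hf1 0 h0, one_pow]) with h1 | h1
    · exact ⟨1, Or.inl rfl, by simpa using h1⟩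
    · exact ⟨-1, Or.inr rfl, by simpa using h1⟩
  have hfs' := h01 ▸ hfs
  simp only [hf] at hfs hfs'
  rw [div_eq_iff (hne 0 h0)] at hfs
  rw [div_eq_iff (hne 1 h1)] at hfs'
  refine ⟨s, hs, ?_, ?_⟩
  · simpa [planePath, hP, hQ] using hfs
  · simpa [planePath, hP, hQ] using hfs'

/-- Reflection at the diagonal is `z ↦ I * conj z`, so `sqrtBranch I * conj ψ` is a square root of
the swapped path; `k` and `l` record how the branch differs at the two ends. -/
theorem turn_swap {p q : ℝ → ℝ} (hp : Continuous p) (hq : Continuous q) {a b : ℝ}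
    (hab : a ≤ b) (h0 : ∀ x ∈ Icc a b, p x = 0 → q x ≠ 0) {k l : ℤ}
    (hk : k = 1 ∨ k = -1) (hl : l = 1 ∨ l = -1)
    (hka : sqrtBranch (q a + p a * I) = k * (sqrtBranch I * conj (sqrtBranch (p a + q a * I))))
    (hlb : sqrtBranch (q b + p b * I) = l * (sqrtBranch I * conj (sqrtBranch (p b + q b * I)))) :
    turn q p a b = k * l * turn p q a b := by
  obtain ⟨ψ, hψ, h⟩ := exists_turn_spec hp hq hab h0
  have hs := turn_eq_one_or p q a b
  set s := turn p q a b
  have hψ' : IsSqrtPath q p a b (fun x => sqrtBranch I * conj (ψ x)) := by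
    refine ⟨continuousOn_const.mul (continuous_conj.comp_continuousOn hψ.1), fun x hx => ?_⟩
    rw [mul_pow, ← map_pow, hψ.2 x hx, sqrtBranch_sq]
    simp only [planePath, map_add, map_mul, conj_ofReal, conj_I]
    linear_combination (q x : ℂ) * I_sq * (-1)
  have h' := congrArg conj h
  simp only [map_mul, map_intCast] at h'
  have hl2 : (l : ℂ) * l = 1 := by rcases hl with rfl | rfl <;> simp
  refine turn_eq hab (fun x hx hqx hpx => h0 x hx hpx hqx) hψ' ?_ ?_
  · rcases hk with rfl | rfl <;> rcases hl with rfl | rfl <;> rcases hs with hs | hs <;> simp [hs]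
  · simp only [planePath] at h' ⊢
    rw [hka, hlb]
    push_cast
    linear_combination (k : ℂ) * sqrtBranch I ^ 2 * h' -
      k * s * sqrtBranch I ^ 2 * conj (ψ a) * conj (sqrtBranch (p b + q b * I)) * hl2

/-- Exchanging the coordinates of two paths with end points in the same quadrants changes both
signs in the same way. -/
theorem turn_mul_turn_swap {p q p' q' : ℝ → ℝ} (hp : Continuous p) (hq : Continuous q)
    (hp' : Continuous p') (hq' : Continuous q') {a b : ℝ} (hab : a ≤ b)
    (h0 : ∀ x ∈ Icc a b, p x = 0 → q x ≠ 0) (h0' : ∀ x ∈ Icc a b, p' x = 0 → q' x ≠ 0)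
    (hpa : 0 < p a * p' a) (hqa : 0 < q a * q' a) (hpb : 0 < p b * p' b) (hqb : 0 < q b * q' b) :
    turn q p a b * turn q' p' a b = turn p q a b * turn p' q' a b := by
  -- Both paths get the same factors `k` and `l`, which square away in the product.
  obtain ⟨k, hk, hka, hka'⟩ := exists_sqrtBranch_swap hpa hqa
  obtain ⟨l, hl, hlb, hlb'⟩ := exists_sqrtBranch_swap hpb hqb
  rw [turn_swap hp hq hab h0 hk hl hka hlb, turn_swap hp' hq' hab h0' hk hl hka' hlb']
  rcases hk with rfl | rfl <;> rcases hl with rfl | rfl <;> ring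

end Turn

/-! ### Parity of the multiplicity as a boundary sign -/

section BoundarySign

open Set Filter Topology

/-- The function `x ↦ P(x, y)`. -/
noncomputable def slice (P : MvPolynomial (Fin 2) ℝ) (y x : ℝ) : ℝ :=
  MvPolynomial.eval ![x, y] P

@[fun_prop]
theorem continuous_slice {X : Type*} [TopologicalSpace X] (P : MvPolynomial (Fin 2) ℝ)
    {f g : X → ℝ} (hf : Continuous f) (hg : Continuous g) :
    Continuous fun z => slice P (f z) (g z) := by
  unfold slice
  refine (MvPolynomial.continuous_eval P).comp (continuous_pi fun i => ?_)
  fin_cases i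
  · exact hg
  · exact hf

theorem slice_zero (P : MvPolynomial (Fin 2) ℝ) (x : ℝ) : slice P 0 x = (axis P).eval x :=
  (eval_axis P x).symm

theorem slice_X_one_mul (H : MvPolynomial (Fin 2) ℝ) (y x : ℝ) :
    slice (MvPolynomial.X 1 * H) y x = y * slice H y x := by
  simp [slice]

theorem slice_mul_sub (u v : Polynomial ℝ) (P Q : MvPolynomial (Fin 2) ℝ) (y x : ℝ) :
    slice (fromAxis u * Q - fromAxis v * P) y x =
      u.eval x * slice Q y x - v.eval x * slice P y x := by
  simp [slice]

/-- The parity, as a sign, of the winding number of `(P, Q)` along the boundary of a rectangle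
with center `(ρ, 0)` on whose vertical sides `P` has no zeros. -/
noncomputable def boundarySign (P Q : MvPolynomial (Fin 2) ℝ) (ρ δ ε : ℝ) : ℤ :=
  turn (slice P ε) (slice Q ε) (ρ - δ) (ρ + δ) * turn (slice P (-ε)) (slice Q (-ε)) (ρ - δ) (ρ + δ)

/-- Common zeros of `P` and `Q` in the rectangle lie on the axis, and `P` has no zeros on the
vertical sides. -/
structure IsIsolating (P Q : MvPolynomial (Fin 2) ℝ) (ρ δ ε : ℝ) : Prop where
  width_pos : 0 < δ
  height_pos : 0 < ε
  ne_zero : ∀ y ∈ Icc (-ε) ε, y ≠ 0 → ∀ x ∈ Icc (ρ - δ) (ρ + δ), slice P y x = 0 → slice Q y x ≠ 0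
  left : ∀ y ∈ Icc (-ε) ε, slice P y (ρ - δ) ≠ 0
  right : ∀ y ∈ Icc (-ε) ε, slice P y (ρ + δ) ≠ 0

namespace IsIsolating

variable {P Q : MvPolynomial (Fin 2) ℝ} {ρ δ ε : ℝ}

theorem le (h : IsIsolating P Q ρ δ ε) : ρ - δ ≤ ρ + δ := by linarith [h.width_pos]

theorem top_mem (h : IsIsolating P Q ρ δ ε) : ε ∈ Icc (-ε) ε :=
  ⟨by linarith [h.height_pos], le_rfl⟩

theorem bot_mem (h : IsIsolating P Q ρ δ ε) : -ε ∈ Icc (-ε) ε :=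
  ⟨le_rfl, by linarith [h.height_pos]⟩

theorem ne_zero_top (h : IsIsolating P Q ρ δ ε) :
    ∀ x ∈ Icc (ρ - δ) (ρ + δ), slice P ε x = 0 → slice Q ε x ≠ 0 :=
  h.ne_zero ε h.top_mem h.height_pos.ne'

theorem ne_zero_bot (h : IsIsolating P Q ρ δ ε) :
    ∀ x ∈ Icc (ρ - δ) (ρ + δ), slice P (-ε) x = 0 → slice Q (-ε) x ≠ 0 :=
  h.ne_zero (-ε) h.bot_mem (neg_ne_zero.mpr h.height_pos.ne')

/-- Without common zeros, even on the axis, sweeping the bottom side up to the top is an admissible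
homotopy, so the two signs agree. -/
theorem boundarySign_eq_one (h : IsIsolating P Q ρ δ ε)
    (h0 : ∀ y ∈ Icc (-ε) ε, ∀ x ∈ Icc (ρ - δ) (ρ + δ), slice P y x = 0 → slice Q y x ≠ 0) :
    boundarySign P Q ρ δ ε = 1 := by
  rw [boundarySign, turn_homotopy (p := slice P) (q := slice Q) (by fun_prop) (by fun_prop)
    (by linarith [h.height_pos] : -ε ≤ ε) h.le h0 h.left h.right]
  rcases turn_eq_one_or (slice P ε) (slice Q ε) (ρ - δ) (ρ + δ) with h | h <;> simp [h]

/-- At a zero of `P` the new second coordinate is `u Q` with `u > 0`, so the straight-line homotopy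
from `Q` never passes through the origin. -/
theorem boundarySign_mul_sub (h : IsIsolating P Q ρ δ ε) (u v : Polynomial ℝ)
    (hu : ∀ x ∈ Icc (ρ - δ) (ρ + δ), 0 < u.eval x) :
    boundarySign P (fromAxis u * Q - fromAxis v * P) ρ δ ε = boundarySign P Q ρ δ ε := by
  have key : ∀ y ∈ Icc (-ε) ε, y ≠ 0 →
      turn (slice P y) (slice (fromAxis u * Q - fromAxis v * P) y) (ρ - δ) (ρ + δ) =
        turn (slice P y) (slice Q y) (ρ - δ) (ρ + δ) := by
    intro y hy hy0
    have := turn_homotopy (p := fun _ => slice P y)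
      (q := fun t x => (1 - t) * slice Q y x +
        t * (u.eval x * slice Q y x - v.eval x * slice P y x))
      (by fun_prop) (by fun_prop) zero_le_one h.le (fun t ht x hx hP => ?_)
      (fun _ _ => h.left y hy) (fun _ _ => h.right y hy)
    · simp only [sub_zero, one_mul, zero_mul, add_zero, sub_self, zero_add] at this
      rw [this]
      congr 1
      funext x
      rw [slice_mul_sub]
    · rw [hP, mul_zero, sub_zero, ← mul_assoc, ← add_mul]
      refine mul_ne_zero ?_ (h.ne_zero y hy hy0 x hx hP)
      have := hu x hx
      rcases ht.1.eq_or_lt with h | h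
      · rw [← h]
        simp
      · have := mul_pos h this
        linarith [ht.2]
  rw [boundarySign, key ε h.top_mem h.height_pos.ne',
    key (-ε) h.bot_mem (neg_ne_zero.mpr h.height_pos.ne'), boundarySign]

/-- The second variable is the constant `ε` on the top side and `-ε` on the bottom side. The
positive factor can be deformed to `1`, and the remaining reflection at the bottom is governed by
`turn_neg`. -/
theorem boundarySign_X_one_mul {H : MvPolynomial (Fin 2) ℝ}
    (h : IsIsolating P (MvPolynomial.X 1 * H) ρ δ ε) :
    boundarySign P (MvPolynomial.X 1 * H) ρ δ ε =
      (if slice P (-ε) (ρ - δ) * slice P (-ε) (ρ + δ) < 0 then -1 else 1) *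
        boundarySign P H ρ δ ε := by
  have hH : ∀ y ∈ Icc (-ε) ε, y ≠ 0 → ∀ x ∈ Icc (ρ - δ) (ρ + δ),
      slice P y x = 0 → slice H y x ≠ 0 := fun y hy hy0 x hx hP hH =>
    h.ne_zero y hy hy0 x hx hP (by rw [slice_X_one_mul, hH, mul_zero])
  have hscale : ∀ y ∈ Icc (-ε) ε, y ≠ 0 → ∀ s : ℝ, s ≠ 0 →
      turn (slice P y) (fun x => s * (ε * slice H y x)) (ρ - δ) (ρ + δ) =
        turn (slice P y) (fun x => s * slice H y x) (ρ - δ) (ρ + δ) := by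
    intro y hy hy0 s hs
    have := turn_homotopy (p := fun _ => slice P y)
      (q := fun t x => s * (((1 - t) * ε + t) * slice H y x))
      (by fun_prop) (by fun_prop) zero_le_one h.le (fun t ht x hx hP => ?_)
      (fun _ _ => h.left y hy) (fun _ _ => h.right y hy)
    · simpa only [sub_zero, one_mul, zero_mul, add_zero, sub_self, zero_add] using this
    · refine mul_ne_zero hs (mul_ne_zero ?_ (hH y hy hy0 x hx hP))
      have := h.height_pos
      rcases ht.1.eq_or_lt with h | h
      · rw [← h]
        simpa using this.ne'
      · have := mul_nonneg (sub_nonneg.mpr ht.2) this.le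
        linarith
  have htop : turn (slice P ε) (slice (MvPolynomial.X 1 * H) ε) (ρ - δ) (ρ + δ) =
      turn (slice P ε) (slice H ε) (ρ - δ) (ρ + δ) := by
    have := hscale ε h.top_mem h.height_pos.ne' 1 one_ne_zero
    simp only [one_mul] at this
    rw [← this]
    congr 1
    funext x
    rw [slice_X_one_mul]
  have hbot : turn (slice P (-ε)) (slice (MvPolynomial.X 1 * H) (-ε)) (ρ - δ) (ρ + δ) =
      (if slice P (-ε) (ρ - δ) * slice P (-ε) (ρ + δ) < 0 then -1 else 1) *
        turn (slice P (-ε)) (slice H (-ε)) (ρ - δ) (ρ + δ) := by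
    have := hscale (-ε) h.bot_mem (neg_ne_zero.mpr h.height_pos.ne') (-1) (by norm_num)
    simp only [neg_mul, one_mul] at this
    rw [turn_neg (by fun_prop) (by fun_prop) h.le
      (hH (-ε) h.bot_mem (neg_ne_zero.mpr h.height_pos.ne')) (h.left _ h.bot_mem)
      (h.right _ h.bot_mem)] at this
    rw [← this]
    congr 1
    funext x
    rw [slice_X_one_mul, neg_mul]
  rw [boundarySign, htop, hbot, boundarySign]
  ring

theorem mul_pos_of_ne_zero {F : MvPolynomial (Fin 2) ℝ} {x : ℝ} (hε : 0 < ε)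
    (h : ∀ y ∈ Icc (-ε) ε, slice F y x ≠ 0) : 0 < slice F ε x * slice F (-ε) x := by
  by_contra hneg
  have hc : ContinuousOn (fun y => slice F y x) (Icc (-ε) ε) :=
    Continuous.continuousOn (by fun_prop)
  have hle : -ε ≤ ε := by linarith
  rcases mul_nonpos_iff.mp (not_lt.mp hneg) with ⟨h1, h2⟩ | ⟨h1, h2⟩
  · obtain ⟨y, hy, hy0⟩ := intermediate_value_Icc hle hc ⟨h2, h1⟩
    exact h y hy hy0
  · obtain ⟨y, hy, hy0⟩ := intermediate_value_Icc' hle hc ⟨h1, h2⟩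
    exact h y hy hy0

/-- As neither polynomial vanishes on the vertical sides, the ends of the top and bottom paths above
each other lie in the same open quadrant. -/
theorem boundarySign_comm (h : IsIsolating P Q ρ δ ε) (h' : IsIsolating Q P ρ δ ε) :
    boundarySign Q P ρ δ ε = boundarySign P Q ρ δ ε :=
  turn_mul_turn_swap (by fun_prop) (by fun_prop) (by fun_prop) (by fun_prop) h.le
    h.ne_zero_top h.ne_zero_bot
    (mul_pos_of_ne_zero h.height_pos h.left) (mul_pos_of_ne_zero h.height_pos h'.left)
    (mul_pos_of_ne_zero h.height_pos h.right) (mul_pos_of_ne_zero h.height_pos h'.right)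

end IsIsolating

variable {ρ : ℝ}

theorem eventually_rectangle {A : ℝ → ℝ → Prop} (h : ∀ᶠ z : ℝ × ℝ in 𝓝 (ρ, 0), A z.2 z.1) :
    ∀ᶠ δ in 𝓝[>] (0 : ℝ), ∀ᶠ ε in 𝓝[>] (0 : ℝ),
      ∀ y ∈ Icc (-ε) ε, ∀ x ∈ Icc (ρ - δ) (ρ + δ), A y x := by
  obtain ⟨r, hr, hA⟩ := Metric.eventually_nhds_iff.mp h
  have hlt : ∀ᶠ δ in 𝓝[>] (0 : ℝ), δ < r :=
    eventually_nhdsWithin_of_eventually_nhds (eventually_lt_nhds hr)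
  filter_upwards [hlt] with δ hδ
  filter_upwards [hlt] with ε hε y hy x hx
  refine hA (y := (x, y)) ?_
  rw [Prod.dist_eq, max_lt_iff, Real.dist_eq, Real.dist_eq, abs_lt, abs_lt]
  exact ⟨⟨by linarith [hx.1], by linarith [hx.2]⟩, ⟨by linarith [hy.1], by linarith [hy.2]⟩⟩

theorem eventually_eval_ne_zero {p : Polynomial ℝ} (hp : p ≠ 0) (ρ : ℝ) :
    ∀ᶠ x in 𝓝[≠] ρ, p.eval x ≠ 0 := by
  have hfin : ({x | p.IsRoot x} \ {ρ}).Finite := (Polynomial.finite_setOfPred_isRoot hp).sdiff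
  have hev : ∀ᶠ x in 𝓝 ρ, x ∉ {x | p.IsRoot x} \ {ρ} :=
    hfin.isClosed.isOpen_compl.mem_nhds (by simp)
  rw [eventually_nhdsWithin_iff]
  filter_upwards [hev] with x hx hxρ h0
  exact hx ⟨h0, hxρ⟩

theorem tendsto_add_nhdsGT (ρ : ℝ) : Tendsto (fun δ => ρ + δ) (𝓝[>] 0) (𝓝[≠] ρ) := by
  refine tendsto_nhdsWithin_iff.mpr ⟨?_, ?_⟩
  · refine Tendsto.mono_left ?_ nhdsWithin_le_nhds
    exact (continuous_const.add continuous_id).tendsto' _ _ (by simp)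
  · filter_upwards [self_mem_nhdsWithin] with δ (hδ : 0 < δ) h
    exact hδ.ne' (by simpa using h)

theorem tendsto_sub_nhdsGT (ρ : ℝ) : Tendsto (fun δ => ρ - δ) (𝓝[>] 0) (𝓝[≠] ρ) := by
  refine tendsto_nhdsWithin_iff.mpr ⟨?_, ?_⟩
  · refine Tendsto.mono_left ?_ nhdsWithin_le_nhds
    exact (continuous_const.sub continuous_id).tendsto' _ _ (by simp)
  · filter_upwards [self_mem_nhdsWithin] with δ (hδ : 0 < δ) h
    exact hδ.ne' (by simpa using h)

theorem eventually_Icc_of_nhds {A : ℝ → Prop} (h : ∀ᶠ y in 𝓝 (0 : ℝ), A y) :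
    ∀ᶠ ε in 𝓝[>] (0 : ℝ), ∀ y ∈ Icc (-ε) ε, A y := by
  obtain ⟨r, hr, hA⟩ := Metric.eventually_nhds_iff.mp h
  filter_upwards [eventually_nhdsWithin_of_eventually_nhds (eventually_lt_nhds hr)] with ε hε y hy
  refine hA ?_
  rw [Real.dist_eq, abs_lt]
  exact ⟨by linarith [hy.1], by linarith [hy.2]⟩

/-- The order of the quantifiers matters: `δ` is chosen so that `P` is nonzero at `ρ ± δ` on the
axis, and `ε`, depending on `δ`, so that this persists along the vertical sides. -/
theorem eventually_isIsolating {P Q : MvPolynomial (Fin 2) ℝ} (hP : axis P ≠ 0)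
    (h : ∀ᶠ z : ℝ × ℝ in 𝓝 (ρ, 0), slice P z.2 z.1 = 0 → slice Q z.2 z.1 = 0 → z.2 = 0) :
    ∀ᶠ δ in 𝓝[>] (0 : ℝ), ∀ᶠ ε in 𝓝[>] (0 : ℝ), IsIsolating P Q ρ δ ε := by
  have hne := eventually_eval_ne_zero hP ρ
  have hside : ∀ x, (axis P).eval x ≠ 0 →
      ∀ᶠ ε in 𝓝[>] (0 : ℝ), ∀ y ∈ Icc (-ε) ε, slice P y x ≠ 0 := by
    intro x hx
    apply eventually_Icc_of_nhds
    rw [← slice_zero] at hx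
    exact (Continuous.continuousAt (by fun_prop : Continuous fun y => slice P y x)).eventually_ne hx
  filter_upwards [eventually_rectangle (A := fun y x => slice P y x = 0 → slice Q y x = 0 → y = 0) h,
    (tendsto_sub_nhdsGT ρ).eventually hne, (tendsto_add_nhdsGT ρ).eventually hne,
    self_mem_nhdsWithin] with δ hδ hl hr hδ0
  filter_upwards [hδ, hside _ hl, hside _ hr, self_mem_nhdsWithin] with ε hε hl hr hε0
  exact ⟨hδ0, hε0, fun y hy hy0 x hx hP hQ => hy0 (hε y hy x hx hP hQ), hl, hr⟩

/-- A polynomial changes sign at a point according to the parity of its order there. -/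
theorem eventually_sign_eq {P : MvPolynomial (Fin 2) ℝ} (hP : axis P ≠ 0) :
    ∀ᶠ δ in 𝓝[>] (0 : ℝ), ∀ᶠ ε in 𝓝[>] (0 : ℝ),
      (if slice P (-ε) (ρ - δ) * slice P (-ε) (ρ + δ) < 0 then -1 else 1 : ℤ) =
        (-1) ^ (axis P).rootMultiplicity ρ := by
  obtain ⟨p, hp, hpr⟩ := Polynomial.exists_eq_pow_rootMultiplicity_mul_and_not_dvd _ hP ρ
  set r := (axis P).rootMultiplicity ρ
  rw [Polynomial.dvd_iff_isRoot] at hpr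
  have hpos : ∀ᶠ δ in 𝓝[>] (0 : ℝ), 0 < p.eval (ρ - δ) * p.eval (ρ + δ) := by
    apply eventually_nhdsWithin_of_eventually_nhds
    have hc : Continuous fun δ : ℝ => p.eval (ρ - δ) * p.eval (ρ + δ) := by fun_prop
    refine hc.continuousAt.eventually_const_lt ?_
    simpa using mul_self_pos.mpr hpr
  filter_upwards [hpos, self_mem_nhdsWithin] with δ hδ (hδ0 : 0 < δ)
  -- The sign is read off on the axis, where `P` is `(x - ρ) ^ r * p`, and carried to height `-ε` by
  -- continuity.
  have hval : slice P 0 (ρ - δ) * slice P 0 (ρ + δ) =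
      (-1) ^ r * ((δ ^ r) ^ 2 * (p.eval (ρ - δ) * p.eval (ρ + δ))) := by
    rw [slice_zero, slice_zero, hp]
    simp only [Polynomial.eval_mul, Polynomial.eval_pow, Polynomial.eval_sub, Polynomial.eval_X,
      Polynomial.eval_C]
    rw [show ρ - δ - ρ = (-1) * δ by ring, show ρ + δ - ρ = δ by ring, mul_pow]
    ring
  have hq : 0 < (δ ^ r) ^ 2 * (p.eval (ρ - δ) * p.eval (ρ + δ)) :=
    mul_pos (by positivity) hδ
  have hc : Continuous fun ε : ℝ => slice P (-ε) (ρ - δ) * slice P (-ε) (ρ + δ) := by fun_prop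
  rcases Nat.even_or_odd r with hr | hr
  · rw [hr.neg_one_pow, one_mul] at hval
    rw [hr.neg_one_pow]
    filter_upwards [eventually_nhdsWithin_of_eventually_nhds
      ((hc.tendsto 0).eventually_const_lt (u := 0) (by simpa [hval] using hq))] with ε hε
    rw [if_neg (not_lt.mpr hε.le)]
  · rw [hr.neg_one_pow] at hval
    rw [hr.neg_one_pow]
    filter_upwards [eventually_nhdsWithin_of_eventually_nhds
      ((hc.tendsto 0).eventually_lt_const (u := 0) (by
        simp only [neg_zero, hval]
        linarith))] with ε hε
    rw [if_pos hε]

/-- Common zeros near `(ρ, 0)` lie on the axis, and small rectangles have the sign `(-1)ⁿ`. -/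
def HasLocalSign (ρ : ℝ) (P Q : MvPolynomial (Fin 2) ℝ) (n : ℕ) : Prop :=
  (∀ᶠ z : ℝ × ℝ in 𝓝 (ρ, 0), slice P z.2 z.1 = 0 → slice Q z.2 z.1 = 0 → z.2 = 0) ∧
    ∀ᶠ δ in 𝓝[>] (0 : ℝ), ∀ᶠ ε in 𝓝[>] (0 : ℝ), boundarySign P Q ρ δ ε = (-1) ^ n

theorem hasLocalSign_zero {P Q : MvPolynomial (Fin 2) ℝ} (hP : axis P ≠ 0)
    (h : MvPolynomial.eval ![ρ, 0] P ≠ 0 ∨ MvPolynomial.eval ![ρ, 0] Q ≠ 0) :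
    HasLocalSign ρ P Q 0 := by
  have hev : ∀ᶠ z : ℝ × ℝ in 𝓝 (ρ, 0), slice P z.2 z.1 = 0 → slice Q z.2 z.1 ≠ 0 := by
    have hne : ∀ F : MvPolynomial (Fin 2) ℝ, MvPolynomial.eval ![ρ, 0] F ≠ 0 →
        ∀ᶠ z : ℝ × ℝ in 𝓝 (ρ, 0), slice F z.2 z.1 ≠ 0 := fun F hF =>
      (Continuous.continuousAt (by fun_prop :
        Continuous fun z : ℝ × ℝ => slice F z.2 z.1)).eventually_ne hF
    rcases h with h | h
    · filter_upwards [hne P h] with z hz hz'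
      exact absurd hz' hz
    · filter_upwards [hne Q h] with z hz _
      exact hz
  have hiso : ∀ᶠ z : ℝ × ℝ in 𝓝 (ρ, 0), slice P z.2 z.1 = 0 → slice Q z.2 z.1 = 0 → z.2 = 0 := by
    filter_upwards [hev] with z hz h1 h2
    exact absurd h2 (hz h1)
  refine ⟨hiso, ?_⟩
  filter_upwards [eventually_isIsolating hP hiso,
    eventually_rectangle (A := fun y x => slice P y x = 0 → slice Q y x ≠ 0) hev] with δ h1 h2
  filter_upwards [h1, h2] with ε h1 h2
  rw [h1.boundarySign_eq_one h2, pow_zero]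

theorem HasLocalSign.symm {P Q : MvPolynomial (Fin 2) ℝ} {n : ℕ} (hP : axis P ≠ 0)
    (hQ : axis Q ≠ 0) (h : HasLocalSign ρ P Q n) : HasLocalSign ρ Q P n := by
  have hiso : ∀ᶠ z : ℝ × ℝ in 𝓝 (ρ, 0), slice Q z.2 z.1 = 0 → slice P z.2 z.1 = 0 → z.2 = 0 :=
    h.1.mono fun z hz h1 h2 => hz h2 h1
  refine ⟨hiso, ?_⟩
  filter_upwards [h.2, eventually_isIsolating hP h.1, eventually_isIsolating hQ hiso]
    with δ h1 h2 h3
  filter_upwards [h1, h2, h3] with ε h1 h2 h3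
  rw [h2.boundarySign_comm h3, h1]

/-- One Euclidean step on the sign side, matching `localRank_X_one_mul` and `localRank_X_one`; `u`
is positive near `ρ` because `u(ρ) = 1`. -/
theorem HasLocalSign.of_mul_sub {P Q H : MvPolynomial (Fin 2) ℝ} {k : ℕ} (hP : axis P ≠ 0)
    {u v : Polynomial ℝ} (hu : u.eval ρ = 1)
    (hH : fromAxis u * Q - fromAxis v * P = MvPolynomial.X 1 * H) (h : HasLocalSign ρ P H k) :
    HasLocalSign ρ P Q ((axis P).rootMultiplicity ρ + k) := by
  have hHs : ∀ y x, u.eval x * slice Q y x - v.eval x * slice P y x = y * slice H y x := by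
    intro y x
    rw [← slice_mul_sub, hH, slice_X_one_mul]
  have hupos : ∀ᶠ z : ℝ × ℝ in 𝓝 (ρ, 0), 0 < u.eval z.1 := by
    have hc : Continuous fun z : ℝ × ℝ => u.eval z.1 := by fun_prop
    exact hc.continuousAt.eventually_const_lt (by simp [hu])
  have hiso' : ∀ᶠ z : ℝ × ℝ in 𝓝 (ρ, 0),
      slice P z.2 z.1 = 0 → slice (MvPolynomial.X 1 * H) z.2 z.1 = 0 → z.2 = 0 := by
    filter_upwards [h.1] with z hz hP hQ
    rw [slice_X_one_mul] at hQ
    rcases mul_eq_zero.mp hQ with h | h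
    · exact h
    · exact hz hP h
  have hiso : ∀ᶠ z : ℝ × ℝ in 𝓝 (ρ, 0), slice P z.2 z.1 = 0 → slice Q z.2 z.1 = 0 → z.2 = 0 := by
    filter_upwards [hiso'] with z hz hP hQ
    refine hz hP ?_
    rw [slice_X_one_mul, ← hHs, hP, hQ]
    ring
  refine ⟨hiso, ?_⟩
  filter_upwards [h.2, eventually_isIsolating hP hiso, eventually_isIsolating hP hiso',
    eventually_rectangle (A := fun _ x => 0 < u.eval x) hupos, eventually_sign_eq (ρ := ρ) hP]
    with δ h1 h2 h3 h4 h5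
  filter_upwards [h1, h2, h3, h4, h5] with ε h1 h2 h3 h4 h5
  rw [← h2.boundarySign_mul_sub u v (h4 ε h2.top_mem), hH, h3.boundarySign_X_one_mul, h5, h1,
    pow_add]

/-- The parity of the local intersection multiplicity of two real plane curves is determined by
the signs of the equations along the boundary of a small rectangle. -/
theorem hasLocalSign_of_localRank (n : ℕ) :
    ∀ P Q : MvPolynomial (Fin 2) ℝ, axis P ≠ 0 →
      Cardinal.toENat (localRank ρ P Q) = n → HasLocalSign ρ P Q n := by
  induction n using Nat.strong_induction_on with
  | _ n ih =>
    -- The Euclidean step when `P` has the smaller order on the axis; `axis Q = 0` is allowed.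
    have step : ∀ P Q : MvPolynomial (Fin 2) ℝ, axis P ≠ 0 →
        Cardinal.toENat (localRank ρ P Q) = n → MvPolynomial.eval ![ρ, 0] P = 0 →
        (Polynomial.X - Polynomial.C ρ) ^ (axis P).rootMultiplicity ρ ∣ axis Q →
        HasLocalSign ρ P Q n := by
      intro P Q hP hn hP0 ⟨q, hq⟩
      obtain ⟨p, hp, hpr⟩ := Polynomial.exists_eq_pow_rootMultiplicity_mul_and_not_dvd _ hP ρ
      have hr : 0 < (axis P).rootMultiplicity ρ := by
        rw [Polynomial.rootMultiplicity_pos hP, Polynomial.IsRoot, eval_axis]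
        exact hP0
      rw [Polynomial.dvd_iff_isRoot] at hpr
      -- With `axis P = (x - ρ) ^ r * p` and `axis Q = (x - ρ) ^ r * q`, the combination `p Q - q P`
      -- vanishes on the axis; `c` normalizes the coefficient of `Q` to `1` at `ρ`.
      set c := (p.eval ρ)⁻¹ with hc
      have hu : (Polynomial.C c * p).eval ρ = 1 := by
        rw [Polynomial.eval_mul, Polynomial.eval_C]
        exact inv_mul_cancel₀ hpr
      have hax : axis (fromAxis (Polynomial.C c * p) * Q -
          fromAxis (Polynomial.C c * q) * P) = 0 := by
        rw [map_sub, map_mul axis, map_mul axis, axis_fromAxis, axis_fromAxis, hq]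
        linear_combination (-Polynomial.C c * q) * hp
      obtain ⟨H, hH⟩ := X_one_dvd_iff.mpr hax
      have hu' : MvPolynomial.eval ![ρ, 0] (fromAxis (Polynomial.C c * p)) ≠ 0 := by
        rw [eval_fromAxis]
        simp only [Matrix.cons_val_zero]
        rw [hu]
        exact one_ne_zero
      rw [← localRank_mul_sub ρ P Q (fromAxis (Polynomial.C c * q)) hu', hH,
        localRank_X_one_mul ρ hP, localRank_X_one ρ hP, map_add, map_natCast] at hn
      -- The multiplicity of `P` and `H` is finite because `n` is, and smaller than `n` because `r >
      -- 0`.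
      obtain ⟨k, hk⟩ := ENat.ne_top_iff_exists.mp
        (ne_top_of_le_ne_top (ENat.natCast_ne_top n) (hn ▸ le_add_self))
      rw [← hk, ← Nat.cast_add, Nat.cast_inj] at hn
      rw [← hn]
      exact (ih k (by omega) P H hP hk.symm).of_mul_sub hP hu hH
    intro P Q hP hn
    by_cases h0 : MvPolynomial.eval ![ρ, 0] P ≠ 0 ∨ MvPolynomial.eval ![ρ, 0] Q ≠ 0
    · rw [localRank_eq_zero ρ h0, map_zero] at hn
      obtain rfl : n = 0 := by exact_mod_cast hn.symm
      exact hasLocalSign_zero hP h0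
    · push Not at h0
      by_cases hdvd : (Polynomial.X - Polynomial.C ρ) ^ (axis P).rootMultiplicity ρ ∣ axis Q
      · exact step P Q hP hn h0.1 hdvd
      -- Here `Q` has the smaller order, so the step applies with the roles exchanged.
      · have hQ : axis Q ≠ 0 := fun h => hdvd (h ▸ dvd_zero _)
        rw [← Polynomial.le_rootMultiplicity_iff hQ, not_le] at hdvd
        rw [localRank_comm] at hn
        exact (step Q P hQ hn h0.2
          ((Polynomial.le_rootMultiplicity_iff hP).mp hdvd.le)).symm hQ hP

end BoundarySign

/-! ### The transformed system on the axis -/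

section Toric

variable {K : Type*} [Field K]

/-- The exponent of the image of `x^(a - b)` under the toric change of variables. -/
noncomputable def toricExponent (U : Matrix (Fin 2) (Fin 2) ℤ) (b : Fin 2 → ℤ) (a : Fin 2 →₀ ℕ) :
    Fin 2 →₀ ℕ :=
  Finsupp.equivFunOnFinite.symm fun i => ((U.mulVec (exponentVector a - b)) i).toNat

theorem toricTransform_eq_sum (U : Matrix (Fin 2) (Fin 2) ℤ) (b : Fin 2 → ℤ)
    (P : MvPolynomial (Fin 2) K) {s : Finset (Fin 2 →₀ ℕ)} (hs : P.support ⊆ s) :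
    toricTransform U b P =
      ∑ a ∈ s, MvPolynomial.monomial (toricExponent U b a) (P.coeff a) := by
  refine Finset.sum_subset hs fun a _ ha => ?_
  rw [MvPolynomial.notMem_support_iff.mp ha, map_zero]

theorem toricTransform_sub_C (U : Matrix (Fin 2) (Fin 2) ℤ) (b : Fin 2 → ℤ)
    (P : MvPolynomial (Fin 2) K) (y : K) :
    toricTransform U b (P - MvPolynomial.C y) =
      toricTransform U b P - MvPolynomial.monomial (toricExponent U b 0) y := by
  classical
  have hC : toricTransform U b (MvPolynomial.C y) =
      MvPolynomial.monomial (toricExponent U b 0) y := by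
    rw [toricTransform_eq_sum U b (MvPolynomial.C y) (s := {0}), Finset.sum_singleton,
      MvPolynomial.coeff_zero_C]
    exact MvPolynomial.support_monomial_subset
  set s := (P - MvPolynomial.C y).support ∪ (P.support ∪ (MvPolynomial.C y).support)
  rw [← hC, toricTransform_eq_sum U b (P - MvPolynomial.C y) (s := s) Finset.subset_union_left,
    toricTransform_eq_sum U b P (s := s)
      (Finset.subset_union_left.trans Finset.subset_union_right),
    toricTransform_eq_sum U b (MvPolynomial.C y) (s := s)
      (Finset.subset_union_right.trans Finset.subset_union_right), ← Finset.sum_sub_distrib]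
  refine Finset.sum_congr rfl fun a _ => ?_
  rw [MvPolynomial.coeff_sub, map_sub]

theorem exponentVector_injective : Function.Injective exponentVector := by
  intro a a' h
  ext i
  exact Int.ofNat_inj.mp (congrFun h i)

theorem mulVec_eq_zero_of_mem_toricTransformations {A Γ : Set (Fin 2 → ℝ)} {a₁ : Fin 2 → ℤ}
    {U : Matrix (Fin 2) (Fin 2) ℤ} (hU : U ∈ toricTransformations A Γ a₁) {x : Fin 2 → ℤ}
    (hx : U.mulVec x = 0) : x = 0 := by
  obtain ⟨v, w, -, -, hdet, -, rfl⟩ := hU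
  rw [← Matrix.one_mulVec x, ← Matrix.transpose_one, ← Matrix.nonsing_inv_mul _ hdet,
    Matrix.transpose_mul, ← Matrix.mulVec_mulVec, hx, Matrix.mulVec_zero]

theorem extremePoints_subset_of_isFace {A F : Set (Fin 2 → ℝ)} (h : IsFace A F) :
    F.extremePoints ℝ ⊆ A.extremePoints ℝ := by
  obtain ⟨c, rfl⟩ := h
  refine IsExtreme.extremePoints_subset_extremePoints ⟨fun x hx => hx.1, ?_⟩
  rintro x hx y hy z ⟨-, hz⟩ ⟨s, t, hs, ht, hst, rfl⟩
  refine ⟨hx, fun w hw => le_trans ?_ (hz w hw)⟩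
  have h1 := hz y hy
  rw [dotProduct_add, dotProduct_smul, dotProduct_smul, smul_eq_mul, smul_eq_mul] at h1 ⊢
  obtain rfl : s = 1 - t := by linarith
  nlinarith

theorem exists_mem_support_of_extremePoint {P : MvPolynomial (Fin 2) K} {b : Fin 2 → ℤ}
    (h : latticePoint b ∈ (newtonPolytope P).extremePoints ℝ) :
    ∃ a ∈ P.support, exponentVector a = b := by
  obtain ⟨a, ha, hab⟩ := extremePoints_convexHull_subset h
  refine ⟨a, ha, ?_⟩
  funext i
  exact Int.cast_injective (α := ℝ) (congrFun hab i)

/-- The coefficient at the vertex `b i` survives on the axis. -/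
theorem axis_toricTransform_ne_zero {f : Fin 2 → MvPolynomial (Fin 2) K} {Γ : Set (Fin 2 → ℝ)}
    {a₁ : Fin 2 → ℤ} {b : Fin 2 → Fin 2 → ℤ} {U : Matrix (Fin 2) (Fin 2) ℤ}
    (h0 : ∀ i, MvPolynomial.constantCoeff (f i) ≠ 0)
    (hb : IsVertexDecomposition (newtonPolytope (f 0)) (newtonPolytope (f 1)) Γ a₁ b)
    (hU : U ∈ toricTransformations (newtonPolytopePair f) Γ a₁) (i : Fin 2) :
    axis (toricTransform U (b i) (f i)) ≠ 0 := by
  have hnn : ∀ a ∈ (f i).support, ∀ j, 0 ≤ (U.mulVec (exponentVector a - b i)) j :=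
    fun a ha j => exponent_nonneg h0 hb hU 0 i (by simpa using ha) j
  obtain ⟨Γ₁, Γ₂, hΓ₁, hΓ₂, -, hb0, hb1, -⟩ := hb
  obtain ⟨a, ha, hab⟩ : ∃ a ∈ (f i).support, exponentVector a = b i := by
    fin_cases i
    · exact exists_mem_support_of_extremePoint (extremePoints_subset_of_isFace hΓ₁ hb0)
    · exact exists_mem_support_of_extremePoint (extremePoints_subset_of_isFace hΓ₂ hb1)
  -- No other monomial is sent to the constant one: the exponents are nonnegative, so truncation
  -- loses nothing, and `U` is injective. Thus the coefficient at the vertex becomes the constant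
  -- term.
  have hexp : ∀ a' ∈ (f i).support, toricExponent U (b i) a' = 0 → a' = a := by
    intro a' ha' h
    apply exponentVector_injective
    rw [hab]
    refine sub_eq_zero.mp (mulVec_eq_zero_of_mem_toricTransformations hU ?_)
    funext j
    have h1 : ((U.mulVec (exponentVector a' - b i)) j).toNat = 0 := DFunLike.congr_fun h j
    exact le_antisymm (Int.toNat_eq_zero.mp h1) (hnn a' ha' j)
  have hexp0 : toricExponent U (b i) a = 0 := by
    ext j
    simp [toricExponent, hab]
  have hcoeff : (toricTransform U (b i) (f i)).coeff 0 = (f i).coeff a := by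
    classical
    rw [toricTransform_eq_sum U (b i) (f i) subset_rfl, MvPolynomial.coeff_sum,
      Finset.sum_eq_single_of_mem a ha, hexp0, MvPolynomial.coeff_monomial, if_pos rfl]
    intro a' ha' hne
    rw [MvPolynomial.coeff_monomial, if_neg fun h => hne (hexp a' ha' h)]
  intro h
  have h2 : MvPolynomial.eval ![0, 0] (toricTransform U (b i) (f i)) = 0 := by
    rw [← eval_axis, h, Polynomial.eval_zero]
  have h3 : (![0, 0] : Fin 2 → K) = 0 := by
    ext j
    fin_cases j <;> rfl
  rw [h3, MvPolynomial.eval_zero, MvPolynomial.constantCoeff_eq, hcoeff] at h2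
  exact MvPolynomial.mem_support_iff.mp ha h2

/-- The monomial carrying `y` contains the second variable and dies on the axis. -/
theorem axis_toricTransform_sub_C (U : Matrix (Fin 2) (Fin 2) ℤ) (b : Fin 2 → ℤ)
    (P : MvPolynomial (Fin 2) K) (y : K) (h : toricExponent U b 0 1 ≠ 0) :
    axis (toricTransform U b (P - MvPolynomial.C y)) = axis (toricTransform U b P) := by
  rw [toricTransform_sub_C, map_sub, sub_eq_self, axis, MvPolynomial.aeval_monomial,
    Finsupp.prod_fintype _ _ (fun _ => pow_zero _), Fin.prod_univ_two]
  simp [h]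

theorem mu_eq (f : Fin 2 → MvPolynomial (Fin 2) K) (U : Matrix (Fin 2) (Fin 2) ℤ)
    (b : Fin 2 → Fin 2 → ℤ) (ρ : K) (y : Fin 2 → K) (i : Fin 2) :
    mu f U b ρ y = Cardinal.toENat (localRank ρ (transformedSystem f U b y i)
      (transformedSystem f U b y (1 - i))) := by
  rw [mu, multiplicityAt_eq]
  fin_cases i
  · rfl
  · exact congrArg _ (localRank_comm _ _ _)

end Toric

/-! ### Deforming the value when the topological set is empty -/

section Real

open Set Filter Topology

variable {f : Fin 2 → MvPolynomial (Fin 2) ℝ} {U : Matrix (Fin 2) (Fin 2) ℤ}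
  {b : Fin 2 → Fin 2 → ℤ} {ρ : ℝ}

theorem slice_transformedSystem (f : Fin 2 → MvPolynomial (Fin 2) ℝ)
    (U : Matrix (Fin 2) (Fin 2) ℤ) (b : Fin 2 → Fin 2 → ℤ) (η : Fin 2 → ℝ) (i : Fin 2) (y x : ℝ) :
    slice (transformedSystem f U b η i) y x = slice (toricTransform U (b i) (f i)) y x -
      η i * (x ^ toricExponent U (b i) 0 0 * y ^ toricExponent U (b i) 0 1) := by
  rw [slice, transformedSystem, toricTransform_sub_C, map_sub, MvPolynomial.eval_monomial,
    Finsupp.prod_fintype _ _ (fun _ => pow_zero _), Fin.prod_univ_two]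
  rfl

@[fun_prop]
theorem continuous_slice_transformedSystem {X : Type*} [TopologicalSpace X] {η : X → Fin 2 → ℝ}
    {g h : X → ℝ} (hη : Continuous η) (hg : Continuous g) (hh : Continuous h) (i : Fin 2) :
    Continuous fun z => slice (transformedSystem f U b (η z) i) (g z) (h z) := by
  simp only [slice_transformedSystem]
  fun_prop

theorem TF_nonempty_of_tendsto {z : ℕ → ℝ × ℝ} {η : ℕ → Fin 2 → ℝ} {y : Fin 2 → ℝ}
    (h1 : ∀ k, (z k).1 ≠ 0) (h2 : ∀ k, (z k).2 ≠ 0) (hz : Tendsto z atTop (𝓝 (ρ, 0)))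
    (hη : Tendsto η atTop (𝓝 y))
    (h : ∀ k i, slice (transformedSystem f U b (η k) i) (z k).2 (z k).1 = 0) :
    (TF f U b ρ).Nonempty := by
  refine ⟨y, subset_closure ⟨fun i => ?_, fun k => ![(z k).1, (z k).2], η, ?_, ?_, hη, h⟩⟩
  · have hc : Continuous fun w : (ℝ × ℝ) × (Fin 2 → ℝ) =>
        slice (transformedSystem f U b w.2 i) w.1.2 w.1.1 := by fun_prop
    have ht := (hc.tendsto ((ρ, 0), y)).comp (hz.prodMk_nhds hη)
    refine tendsto_nhds_unique (ht.congr fun k => h k i) tendsto_const_nhds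
  · intro k i
    fin_cases i
    · exact h1 k
    · exact h2 k
  · refine tendsto_pi_nhds.mpr fun i => ?_
    fin_cases i
    · exact (continuous_fst.tendsto _).comp hz
    · exact (continuous_snd.tendsto _).comp hz

/-- If the face multiplicity set is empty, one of the two values enters the transformed system
with a positive power of the second variable. -/
theorem exists_toricExponent_ne_zero (hρ : ρ ≠ 0) (hTF : ¬(TF f U b ρ).Nonempty) :
    ∃ i, toricExponent U (b i) 0 1 ≠ 0 := by
  by_contra! h
  apply hTF
  have hz : Tendsto (fun k : ℕ => (ρ, 1 / ((k : ℝ) + 1))) atTop (𝓝 (ρ, 0)) :=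
    tendsto_const_nhds.prodMk_nhds tendsto_one_div_add_atTop_nhds_zero_nat
  -- On the line `z₁ = ρ` each equation is linear in its value, with coefficient a power of `ρ ≠ 0`;
  -- `F` solves for the values, and these converge as the point descends to `(ρ, 0)`.
  let F : ℝ × ℝ → Fin 2 → ℝ := fun w i =>
    slice (toricTransform U (b i) (f i)) w.2 w.1 / ρ ^ toricExponent U (b i) 0 0
  have hF : Continuous F := by
    refine continuous_pi fun i => ?_
    exact Continuous.div_const (by fun_prop) _
  refine TF_nonempty_of_tendsto (fun _ => hρ) (fun k => ?_) hz ((hF.tendsto _).comp hz)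
    (fun k i => ?_)
  · positivity
  · rw [slice_transformedSystem, h i, pow_zero, mul_one]
    simp only [Function.comp_apply, F]
    rw [div_mul_cancel₀ _ (pow_ne_zero _ hρ), sub_self]

/-- A failure yields common zeros off the axis converging to `(ρ, 0)` with values converging to `y`;
as `ρ ≠ 0`, both coordinates are eventually nonzero, which puts `y` in the topological set. -/
theorem eventually_isolated (hρ : ρ ≠ 0) (hTF : ¬(TF f U b ρ).Nonempty) (y : Fin 2 → ℝ) :
    ∀ᶠ w : (ℝ × ℝ) × (Fin 2 → ℝ) in 𝓝 ((ρ, 0), y),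
      (∀ i, slice (transformedSystem f U b w.2 i) w.1.2 w.1.1 = 0) → w.1.2 = 0 := by
  by_contra hcon
  rw [not_eventually] at hcon
  have hne : ∀ᶠ w : (ℝ × ℝ) × (Fin 2 → ℝ) in 𝓝 ((ρ, 0), y), w.1.1 ≠ 0 :=
    (continuous_fst.comp continuous_fst).continuousAt.eventually_ne hρ
  obtain ⟨w, hw, h⟩ := exists_seq_forall_of_frequently (hcon.and_eventually hne)
  refine hTF (TF_nonempty_of_tendsto (z := fun k => (w k).1) (η := fun k => (w k).2) (y := y)
    (fun k => (h k).2) (fun k h0 => (h k).1 fun _ => h0) ((continuous_fst.tendsto _).comp hw)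
    ((continuous_snd.tendsto _).comp hw) (fun k => ?_))
  by_contra hk
  exact (h k).1 fun h' => absurd h' hk

/-- Along a path of values, small rectangles isolate the common zeros uniformly. -/
theorem eventually_forall_isIsolating (hρ : ρ ≠ 0) (hTF : ¬(TF f U b ρ).Nonempty) {i : Fin 2}
    (hi : toricExponent U (b i) 0 1 ≠ 0) (hax : axis (toricTransform U (b i) (f i)) ≠ 0)
    {γ : ℝ → Fin 2 → ℝ} (hγ : Continuous γ) :
    ∀ᶠ δ in 𝓝[>] (0 : ℝ), ∀ᶠ ε in 𝓝[>] (0 : ℝ), ∀ t ∈ Icc (0 : ℝ) 1,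
      IsIsolating (transformedSystem f U b (γ t) i) (transformedSystem f U b (γ t) (1 - i))
        ρ δ ε := by
  have hiso : ∀ᶠ z : ℝ × ℝ in 𝓝 (ρ, 0), ∀ t ∈ Icc (0 : ℝ) 1,
      slice (transformedSystem f U b (γ t) i) z.2 z.1 = 0 →
        slice (transformedSystem f U b (γ t) (1 - i)) z.2 z.1 = 0 → z.2 = 0 := by
    -- Compactness of the parameter interval makes the neighborhood of `(ρ, 0)` independent of `t`.
    refine isCompact_Icc.eventually_forall_of_forall_eventually (fun t _ => ?_)
    have hc : Tendsto (fun z : (ℝ × ℝ) × ℝ => (z.1, γ z.2)) (𝓝 ((ρ, 0), t))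
        (𝓝 ((ρ, 0), γ t)) :=
      (by fun_prop : Continuous fun z : (ℝ × ℝ) × ℝ => (z.1, γ z.2)).tendsto _
    filter_upwards [hc.eventually (eventually_isolated hρ hTF (γ t))] with z hz h1 h2
    refine hz fun j => ?_
    by_cases hj : j = i
    · rw [hj]
      exact h1
    · obtain rfl : j = 1 - i := by omega
      exact h2
  have hside : ∀ x, (axis (toricTransform U (b i) (f i))).eval x ≠ 0 →
      ∀ᶠ ε in 𝓝[>] (0 : ℝ), ∀ y ∈ Icc (-ε) ε, ∀ t ∈ Icc (0 : ℝ) 1,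
        slice (transformedSystem f U b (γ t) i) y x ≠ 0 := by
    intro x hx
    apply eventually_Icc_of_nhds
    refine isCompact_Icc.eventually_forall_of_forall_eventually (fun t _ => ?_)
    have hc : Continuous fun z : ℝ × ℝ => slice (transformedSystem f U b (γ z.2) i) z.1 x := by
      fun_prop
    refine hc.continuousAt.eventually_ne ?_
    simp only [slice_zero]
    rw [transformedSystem, axis_toricTransform_sub_C _ _ _ _ hi]
    exact hx
  have hne := eventually_eval_ne_zero hax ρ
  filter_upwards [eventually_rectangle (A := fun y x => ∀ t ∈ Icc (0 : ℝ) 1,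
      slice (transformedSystem f U b (γ t) i) y x = 0 →
        slice (transformedSystem f U b (γ t) (1 - i)) y x = 0 → y = 0) hiso,
    (tendsto_sub_nhdsGT ρ).eventually hne, (tendsto_add_nhdsGT ρ).eventually hne,
    self_mem_nhdsWithin] with δ hδ hl hr hδ0
  filter_upwards [hδ, hside _ hl, hside _ hr, self_mem_nhdsWithin] with ε hε hl hr hε0 t ht
  exact ⟨hδ0, hε0, fun y hy hy0 x hx h1 h2 => hy0 (hε y hy x hx t ht h1 h2),
    fun y hy => hl y hy t ht, fun y hy => hr y hy t ht⟩

/-- The rectangle isolates for all `t` at once, so moving the value along `γ` is an admissible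
homotopy on each horizontal side. -/
theorem eventually_boundarySign_eq (hρ : ρ ≠ 0) (hTF : ¬(TF f U b ρ).Nonempty) {i : Fin 2}
    (hi : toricExponent U (b i) 0 1 ≠ 0) (hax : axis (toricTransform U (b i) (f i)) ≠ 0)
    {γ : ℝ → Fin 2 → ℝ} (hγ : Continuous γ) :
    ∀ᶠ δ in 𝓝[>] (0 : ℝ), ∀ᶠ ε in 𝓝[>] (0 : ℝ),
      boundarySign (transformedSystem f U b (γ 0) i) (transformedSystem f U b (γ 0) (1 - i)) ρ δ ε =
      boundarySign (transformedSystem f U b (γ 1) i) (transformedSystem f U b (γ 1) (1 - i))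
        ρ δ ε := by
  filter_upwards [eventually_forall_isIsolating hρ hTF hi hax hγ] with δ hδ
  filter_upwards [hδ] with ε h
  have key : ∀ y ∈ Icc (-ε) ε, y ≠ 0 →
      turn (slice (transformedSystem f U b (γ 0) i) y)
        (slice (transformedSystem f U b (γ 0) (1 - i)) y) (ρ - δ) (ρ + δ) =
      turn (slice (transformedSystem f U b (γ 1) i) y)
        (slice (transformedSystem f U b (γ 1) (1 - i)) y) (ρ - δ) (ρ + δ) := fun y hy hy0 =>
    turn_homotopy (p := fun t => slice (transformedSystem f U b (γ t) i) y)
      (q := fun t => slice (transformedSystem f U b (γ t) (1 - i)) y)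
      (by fun_prop) (by fun_prop) zero_le_one (h 0 (by simp)).le
      (fun t ht => (h t ht).ne_zero y hy hy0) (fun t ht => (h t ht).left y hy)
      (fun t ht => (h t ht).right y hy)
  have h0 := h 0 (by simp)
  rw [boundarySign, boundarySign, key ε h0.top_mem h0.height_pos.ne',
    key (-ε) h0.bot_mem (neg_ne_zero.mpr h0.height_pos.ne')]

end Real

end FaceMultiplicity

theorem mainTheorem12 (f : Fin 2 → MvPolynomial (Fin 2) ℝ)
    (hdom : IsDominant f)
    (h0 : ∀ i, MvPolynomial.constantCoeff (f i) ≠ 0)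
    (Γ : Set (Fin 2 → ℝ))
    (hΓ : IsEdge (newtonPolytopePair f) Γ)
    (a₁ : Fin 2 → ℤ) (ha₁ : IsBaseVertex Γ a₁)
    (b : Fin 2 → Fin 2 → ℤ)
    (hb : IsVertexDecomposition (newtonPolytope (f 0)) (newtonPolytope (f 1)) Γ a₁ b)
    (U : Matrix (Fin 2) (Fin 2) ℤ)
    (hU : U ∈ toricTransformations (newtonPolytopePair f) Γ a₁)
    (ρ : ℝ) (hρ : ρ ≠ 0)
    (p q : Fin 2 → ℝ)
    (hp : p ∈ AF f U b ρ) (hq : q ∉ AF f U b ρ)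
    (m n : ℕ) (hm : mu f U b ρ p = m) (hn : mu f U b ρ q = n)
    (hodd : Odd ((m : ℤ) - (n : ℤ))) :
    (TF f U b ρ).Nonempty := by
  by_contra hTF
  obtain ⟨i, hi⟩ := exists_toricExponent_ne_zero hρ hTF
  have hax := axis_toricTransform_ne_zero h0 hb hU i
  have hax' : ∀ y : Fin 2 → ℝ, axis (transformedSystem f U b y i) ≠ 0 := fun y => by
    rw [transformedSystem, axis_toricTransform_sub_C _ _ _ _ hi]
    exact hax
  have hsign := eventually_boundarySign_eq hρ hTF hi hax
    (γ := fun t j => (1 - t) * p j + t * q j) (by fun_prop)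
  rw [mu_eq f U b ρ p i] at hm
  rw [mu_eq f U b ρ q i] at hn
  -- A common rectangle gives `(-1) ^ m = (-1) ^ n`, against the odd difference.
  obtain ⟨δ, hδ, h1, h2⟩ := (hsign.and ((hasLocalSign_of_localRank m _ _ (hax' p) hm).2.and
    (hasLocalSign_of_localRank n _ _ (hax' q) hn).2)).exists
  obtain ⟨ε, hε, h1, h2⟩ := (hδ.and (h1.and h2)).exists
  simp only [sub_zero, one_mul, zero_mul, add_zero, sub_self, zero_add] at hε
  rw [h1, h2] at hε
  rw [Int.odd_sub, Int.odd_coe_nat, Int.even_coe_nat] at hodd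
  rcases Nat.even_or_odd n with h | h
  · rw [h.neg_one_pow, (hodd.mpr h).neg_one_pow] at hε
    norm_num at hε
  · have hme : Even m := by
      rw [← Nat.not_odd_iff_even, hodd]
      exact Nat.not_even_iff_odd.mpr h
    rw [h.neg_one_pow, hme.neg_one_pow] at hε
    norm_num at hε
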